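/- Let $E$ and $E'$ be finite sets, let $\mathcal P(\cdot)$ denote the set of probability measures, let $F:\mathcal P(E)\to\mathbb R$ be twice continuously differentiable, let $\alpha[b]\in\mathcal P(E)$ for $b\in E'$, and let $\pi\in\mathcal P(E')$ with $\pi(b)>0$ for all $b\in E'$. Let $\eta=(\eta(i))_{i\ge1}$ be i.i.d. with law $\pi$; write $\mathbb P_\pi$ for the law of $\eta$ on $(E')^{\infty}$. For $n\ge 1$ let $\mu_{n}[\eta]$ be the finite-volume Gibbs measure $$\mu_{n}[\eta](\omega)=\frac1{Z_n[\eta]}\,e^{-nF(L_n^\omega)}\prod_{i=1}^n\alpha[\eta(i)](\omega(i)),\qquad \omega\in E^n,\quad L_n^\omega=\frac1n\sum_{i=1}^n\delta_{\omega(i)},$$ regarded as a probability measure on $E^\infty$ by putting independent uniformly distributed spins at the sites $i>n$. For $p\in\mathcal P(E')$ and $\hat\nu\in\mathcal P(E)^{E'}$ put $$\Phi[p](\hat\nu)=F\Big(\sum_b p(b)\hat\nu(b)\Big)+\sum_b p(b)\,S(\hat\nu(b)|\alpha[b]),\qquad S(p_1|p_2)=\sum_{a\in E}p_1(a)\log\frac{p_1(a)}{p_2(a)}$$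 ($S(p_1|p_2)=+\infty$ if $p_1\not\ll p_2$), and let $M^*$ be the set of minimizers of $\Phi[\pi]$. For $\hat\nu\in M^*$ write $\pi\hat\nu=\sum_b\pi(b)\hat\nu(b)$ and define its stability vector $B_{\hat\nu}$ as the linear functional $$B_{\hat\nu}[x]=-\Big(dF_{\pi\hat\nu}\Big(\sum_b x(b)\hat\nu(b)\Big)+\sum_b x(b)\,S(\hat\nu(b)|\alpha[b])\Big)$$ on $\{x\in\mathbb R^{E'}:\sum_b x(b)=0\}$. Assume 1) $M^*$ is finite and at every $\hat\nu\in M^*$ all eigenvalues of the Hessian of $\Phi[\pi]$ are strictly positive (the Hessian is taken along the vectors $v=(v(b)(a))$ with $\sum_a v(b)(a)=0$ for all $b$ and $v(b)(a)=0$ whenever $\alpha[b](a)=0$); 2) different elements of $M^*$ have different stability vectors. For $\hat\nu\in M^*$ let $\mu_{\hat\nu}[\eta]=\prod_{i\ge1}\gamma[\eta(i)](\,\cdot\,|\pi\hat\nu)$ be the corresponding pure phase, where $$\gamma[b](a|\nu)=\frac{e^{-dF_\nu(a)}\alpha[b](a)}{\sum_{\bar a\in E}e^{-dF_\nu(\bar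 a)}\alpha[b](\bar a)},\qquad dF_\nu(a):=dF_\nu(\delta_a-\nu).$$ Suppose that there are exactly two pure phases, $M^*=\{\hat\nu_1,\hat\nu_2\}$ with $\hat\nu_1\neq\hat\nu_2$. Then the Aizenman–Wehr metastate exists, i.e. there is a probability measure $J$ on $\mathcal P(E^\infty)\times(E')^\infty$ with $$\lim_{n\to\infty}\int\mathbb P_\pi(d\eta)\,\Xi(\mu_n[\eta],\eta)=\int J(d\mu,d\eta)\,\Xi(\mu,\eta)$$ for every bounded continuous $\Xi$ (product topology on $E^\infty$ and $(E')^\infty$, weak topology on $\mathcal P(E^\infty)$), and its conditional distribution $\kappa[\eta](d\mu)=J(d\mu|\eta)$ is the symmetric mixture $$\kappa[\eta]=\tfrac12\,\delta_{\mu_{\hat\nu_1}[\eta]}+\tfrac12\,\delta_{\mu_{\hat\nu_2}[\eta]}\qquad\text{for }\mathbb P_\pi\text{-a.e. }\eta.$$ No symmetry of the model relating the two phases is assumed. -/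

import Mathlib

open MeasureTheory ProbabilityTheory Filter Topology BoundedContinuousFunction
open scoped ENNReal

namespace MeanField

/-! Elements of `stdSimplex ℝ E` are the probability measures on the finite set `E`. -/

section FreeEnergy

variable {E E' : Type*} [Fintype E] [Fintype E']

/-- The mixture `∑ b, x(b) ν̂(b)`. -/
noncomputable def mix (x : E' → ℝ) (ν : E' → E → ℝ) : E → ℝ :=
  ∑ b, x b • ν b

/-- Relative entropy `S(p | q) = ∑ a, p(a) log (p(a) / q(a))`, for `p` absolutely continuous with
respect to `q` (with `0 log 0 = 0`). It is evaluated at such pairs only. -/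
noncomputable def relEntropy (p q : E → ℝ) : ℝ :=
  ∑ a, p a * Real.log (p a / q a)

/-- The free energy `Φ[x](ν̂) = F(∑ b, x(b) ν̂(b)) + ∑ b, x(b) S(ν̂(b) | α[b])`. -/
noncomputable def freeEnergy (F : (E → ℝ) → ℝ) (α : E' → stdSimplex ℝ E)
    (x : E' → ℝ) (ν : E' → E → ℝ) : ℝ :=
  F (mix x ν) + ∑ b, x b * relEntropy (ν b) (α b)

/-- The vectors `ν̂` of probability measures at which the free energy is finite, i.e. with
`ν̂(b)` absolutely continuous with respect to `α[b]`. This is the whole of `P(E)^E'` when all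
`α[b](a)` are positive. -/
def finiteDomain (α : E' → stdSimplex ℝ E) : Set (E' → E → ℝ) :=
  {ν | (∀ b, ν b ∈ stdSimplex ℝ E) ∧ ∀ b a, α b a = 0 → ν b a = 0}

/-- The set `M*` of minimizers of `ν̂ ↦ Φ[π](ν̂)` over `P(E)^E'` (off `finiteDomain α` the free
energy is `+∞`, as all `π(b)` are positive). -/
def minimizers (F : (E → ℝ) → ℝ) (α : E' → stdSimplex ℝ E) (π : stdSimplex ℝ E') :
    Set (E' → E → ℝ) :=
  {ν | ν ∈ finiteDomain α ∧ ∀ ν' ∈ finiteDomain α, freeEnergy F α π ν ≤ freeEnergy F α π ν'}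

/-- The tangent space of `finiteDomain α`: vectors `v` with `∑ a, v(b)(a) = 0` for all `b`
(and `v(b)(a) = 0` where `α[b](a) = 0`). -/
def tangentSpace (α : E' → stdSimplex ℝ E) : Submodule ℝ (E' → E → ℝ) where
  carrier := {v | (∀ b, ∑ a, v b a = 0) ∧ ∀ b a, α b a = 0 → v b a = 0}
  add_mem' := by
    rintro v w ⟨hv, hv'⟩ ⟨hw, hw'⟩
    refine ⟨fun b => ?_, fun b a h => ?_⟩
    · simp [Finset.sum_add_distrib, hv b, hw b]
    · simp [hv' b a h, hw' b a h]
  zero_mem' := ⟨fun b => by simp, fun b a _ => by simp⟩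
  smul_mem' := by
    rintro c v ⟨hv, hv'⟩
    refine ⟨fun b => ?_, fun b a h => ?_⟩
    · simp [← Finset.mul_sum, hv b]
    · simp [hv' b a h]

/-- The Hessian at `ν̂` of `Φ[π]`, as a bilinear form on the tangent space. -/
noncomputable def hessian (F : (E → ℝ) → ℝ) (α : E' → stdSimplex ℝ E) (π : stdSimplex ℝ E')
    (ν : E' → E → ℝ) (v w : tangentSpace α) : ℝ :=
  iteratedFDeriv ℝ 2 (fun u : tangentSpace α => freeEnergy F α π (ν + (u : E' → E → ℝ))) 0 ![v, w]

/-- Non-degeneracy condition 1): finitely many minimizers, with positive definite Hessian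
(equivalently, all eigenvalues of the Hessian are strictly positive). -/
def NonDegenerate1 (F : (E → ℝ) → ℝ) (α : E' → stdSimplex ℝ E) (π : stdSimplex ℝ E') : Prop :=
  (minimizers F α π).Finite ∧
    ∀ ν ∈ minimizers F α π, ∀ v : tangentSpace α, v ≠ 0 → 0 < hessian F α π ν v v

/-- The differential of `F : P(E) → ℝ` at `ν`. Only its values on vectors of total mass zero
are used; there it is determined by the restriction of `F` to `P(E)`. -/
noncomputable def dF (F : (E → ℝ) → ℝ) (ν : E → ℝ) : (E → ℝ) →L[ℝ] ℝ :=
  fderivWithin ℝ F (stdSimplex ℝ E) ν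

/-- The stability vector `B` of `ν̂`, as a functional on the tangent space
`T P(E') = {x | ∑ b, x(b) = 0}`. -/
noncomputable def stabilityVector (F : (E → ℝ) → ℝ) (α : E' → stdSimplex ℝ E)
    (π : stdSimplex ℝ E') (ν : E' → E → ℝ) (x : {x : E' → ℝ // ∑ b, x b = 0}) : ℝ :=
  -(dF F (mix π ν) (mix x.1 ν) + ∑ b, x.1 b * relEntropy (ν b) (α b))

/-- Non-degeneracy condition 2): different minimizers have different stability vectors. -/
def NonDegenerate2 (F : (E → ℝ) → ℝ) (α : E' → stdSimplex ℝ E) (π : stdSimplex ℝ E') : Prop :=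
  Set.InjOn (stabilityVector F α π) (minimizers F α π)

end FreeEnergy

section Kernels

variable {E E' : Type*} [Fintype E] [DecidableEq E]

/-- `exp(- dF_ν(a)) α[b](a)`, where `dF_ν(a)` stands for `dF_ν(δ_a - ν)`. Evaluating on `δ_a - ν`
fixes the additive constant left free by `dF_ν` being defined on the tangent space; this constant
cancels in `gammaKernel`. -/
noncomputable def gammaWeight (F : (E → ℝ) → ℝ) (α : E' → stdSimplex ℝ E) (b : E') (ν : E → ℝ)
    (a : E) : ℝ :=
  Real.exp (-dF F ν (Pi.single a 1 - ν)) * α b a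

lemma gammaWeight_nonneg (F : (E → ℝ) → ℝ) (α : E' → stdSimplex ℝ E) (b : E') (ν : E → ℝ)
    (a : E) : 0 ≤ gammaWeight F α b ν a :=
  mul_nonneg (Real.exp_pos _).le ((α b).2.1 a)

lemma sum_gammaWeight_pos (F : (E → ℝ) → ℝ) (α : E' → stdSimplex ℝ E) (b : E') (ν : E → ℝ) :
    0 < ∑ a, gammaWeight F α b ν a := by
  obtain ⟨a, -, ha⟩ : ∃ a ∈ Finset.univ, α b a ≠ 0 := by
    apply Finset.exists_ne_zero_of_sum_ne_zero
    exact ne_of_eq_of_ne (α b).2.2 one_ne_zero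
  refine Finset.sum_pos' (fun a _ => gammaWeight_nonneg F α b ν a) ⟨a, Finset.mem_univ a, ?_⟩
  exact mul_pos (Real.exp_pos _) (lt_of_le_of_ne ((α b).2.1 a) (Ne.symm ha))

/-- The kernel `γ[b](· | ν)`. -/
noncomputable def gammaKernel (F : (E → ℝ) → ℝ) (α : E' → stdSimplex ℝ E) (b : E')
    (ν : E → ℝ) : stdSimplex ℝ E :=
  ⟨fun a => gammaWeight F α b ν a / ∑ a', gammaWeight F α b ν a',
    fun a => div_nonneg (gammaWeight_nonneg F α b ν a) (sum_gammaWeight_pos F α b ν).le, by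
      rw [← Finset.sum_div, div_self (sum_gammaWeight_pos F α b ν).ne']⟩

end Kernels

section Measures

variable {E E' : Type*} [Fintype E] [MeasurableSpace E]

/-- A point of the simplex as a measure. -/
noncomputable def law (p : stdSimplex ℝ E) : Measure E :=
  ∑ a, ENNReal.ofReal (p a) • Measure.dirac a

instance isProbabilityMeasure_law (p : stdSimplex ℝ E) : IsProbabilityMeasure (law p) := by
  refine ⟨?_⟩
  simp only [law, Measure.coe_finsetSum, Finset.sum_apply, Measure.smul_apply, measure_univ,
    smul_eq_mul, mul_one]
  have h : ∑ a, p a = 1 := p.2.2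
  have h0 : ∀ a ∈ Finset.univ, 0 ≤ p a := fun a _ => p.2.1 a
  rw [← ENNReal.ofReal_sum_of_nonneg h0, h, ENNReal.ofReal_one]

/-- The law of the i.i.d. disorder variables `η(i) ∼ π`; sites are labelled by `ℕ`, the first `n`
sites being `0, …, n - 1`. -/
noncomputable def disorderLaw [Fintype E'] [MeasurableSpace E'] (π : stdSimplex ℝ E') : Measure (ℕ → E') :=
  Measure.infinitePi fun _ => law π

/-- The a priori product measure for the first `n` sites: `α[η(i)]` at the sites `i < n`, and the
equidistribution on `E` at all other sites. -/
noncomputable def aPriori [Nonempty E] (α : E' → stdSimplex ℝ E) (n : ℕ) (η : ℕ → E') :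
    Measure (ℕ → E) :=
  Measure.infinitePi fun i => law (if i < n then α (η i) else stdSimplex.barycenter)

instance isProbabilityMeasure_aPriori [Nonempty E] (α : E' → stdSimplex ℝ E) (n : ℕ)
    (η : ℕ → E') : IsProbabilityMeasure (aPriori α n η) := by
  unfold aPriori
  infer_instance

variable [DecidableEq E]

/-- The empirical measure `L_n = (1/n) ∑_{i < n} δ_{ω(i)}`. -/
noncomputable def empirical (n : ℕ) (ω : ℕ → E) : E → ℝ :=
  (n : ℝ)⁻¹ • ∑ i ∈ Finset.range n, Pi.single (ω i) 1

lemma integrable_boltzmann [MeasurableSingletonClass E] [Nonempty E] (F : (E → ℝ) → ℝ)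
    (α : E' → stdSimplex ℝ E) (n : ℕ) (η : ℕ → E') :
    Integrable (fun ω => Real.exp (-(n * F (empirical n ω)))) (aPriori α n η) := by
  let g : (Fin n → E) → ℝ := fun σ =>
    Real.exp (-(n * F ((n : ℝ)⁻¹ • ∑ i, Pi.single (σ i) 1)))
  have hg : (fun ω : ℕ → E => Real.exp (-(n * F (empirical n ω)))) =
      fun ω => g (fun i => ω i) := by
    funext ω
    simp only [g, empirical, Finset.sum_range]
  rw [hg]
  have hm : Measurable fun ω : ℕ → E => g (fun i => ω i) :=
    (measurable_of_countable g).comp (measurable_pi_lambda _ fun i => measurable_pi_apply _)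
  refine Integrable.of_bound hm.aestronglyMeasurable (∑ σ, ‖g σ‖) (ae_of_all _ fun ω => ?_)
  exact Finset.single_le_sum (f := fun σ => ‖g σ‖) (fun σ _ => norm_nonneg _) (Finset.mem_univ _)

/-- The finite-volume Gibbs measure
`μ_{F,n}[η](ω) = Z⁻¹ exp(- n F(L_n^ω)) ∏_{i < n} α[η(i)](ω(i))`, extended to a probability measure
on `E^ℕ` by the equidistribution at the sites outside of the volume. -/
noncomputable def gibbs [MeasurableSingletonClass E] [Nonempty E] (F : (E → ℝ) → ℝ)
    (α : E' → stdSimplex ℝ E) (n : ℕ) (η : ℕ → E') : ProbabilityMeasure (ℕ → E) :=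
  ⟨(aPriori α n η).tilted fun ω => -(n * F (empirical n ω)),
    isProbabilityMeasure_tilted (integrable_boltzmann F α n η)⟩

/-- The pure phase `∏_i γ[η(i)](· | π ν̂)`. -/
noncomputable def purePhase [Fintype E'] (F : (E → ℝ) → ℝ) (α : E' → stdSimplex ℝ E)
    (π : stdSimplex ℝ E') (ν : E' → E → ℝ) (η : ℕ → E') : ProbabilityMeasure (ℕ → E) :=
  ⟨Measure.infinitePi fun i => law (gammaKernel F α (η i) (mix π ν)), inferInstance⟩

/-- `κ` is (a version of) the Aizenman-Wehr metastate on the level of the states: for some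
probability measure `J`, the integrals `∫ Ξ(μ_n[η], η) P(dη)` converge to `∫ Ξ dJ` for every
bounded continuous `Ξ`, and `κ[η](dμ) = J(dμ | η)` is a conditional distribution under `J` of the
first coordinate given the second one. -/
def IsAWMetastate [Nonempty E] [TopologicalSpace E] [DiscreteTopology E]
    [MeasurableSingletonClass E] [Fintype E'] [TopologicalSpace E'] [MeasurableSpace E'] (F : (E → ℝ) → ℝ) (α : E' → stdSimplex ℝ E)
    (π : stdSimplex ℝ E') (κ : Kernel (ℕ → E') (ProbabilityMeasure (ℕ → E))) : Prop :=
  ∃ J : Measure (ProbabilityMeasure (ℕ → E) × (ℕ → E')),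
    IsProbabilityMeasure J ∧
    (∀ Ξ : (ProbabilityMeasure (ℕ → E) × (ℕ → E')) →ᵇ ℝ,
      Tendsto (fun n : ℕ => ∫ η, Ξ (gibbs F α n η, η) ∂disorderLaw π) atTop
        (𝓝 (∫ z, Ξ z ∂J))) ∧
    IsMarkovKernel κ ∧ HasCondDistrib Prod.fst Prod.snd κ J

end Measures

end MeanField

/-!
The two minimizers have the same free energy, so which of the two phases dominates in the volume
`n` is decided by the fluctuations of the empirical measure `p_n` of the disorder around `π`. To
first order `Φ[p_n](ν̂ᵢ) - Φ[π](ν̂ᵢ)` is the pairing of `p_n - π` with `disorderGradient F α π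
ν̂ᵢ`, which is up to sign the stability vector. The difference of the two gradients, summed along
the disorder and centred, is the random walk `fluctuation`; it is non-degenerate because the
stability vectors are different.

*Fixed disorder.* If the walk favours `ν̂₁` by at least `δ √n` and `‖p_n - π‖ ≤ δ⁻¹ / √n`, i.e. on
the event `favourable`, then the configurations with empirical measure away from `π ν̂₁` are
negligible. The partition function is bounded below by Jensen's inequality with respect to the
product of the measures `ν̂₁(η(i))` (`exists_exp_le_partitionFunction`), where the term linear in
the deviation of the empirical measure drops out and the error is `o(√n)`. The weight of the bad
configurations is bounded above by the method of types (`sum_boltzmannWeight_le`), with a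
polynomial error. Both errors are beaten by `exp(δ √n)`, so that no Laplace asymptotics are needed
(`tendsto_sum_far_div_partitionFunction`). While the empirical measure is close to `π ν̂₁`,
changing finitely many spins changes the weights as in the product measure with the kernels
`γ[η(i)](· | π ν̂₁)` (`boltzmannWeight_append_mul_le`). Hence the Gibbs measures converge to the
pure phase along these volumes (`tendsto_gibbs_purePhase`).

*Random disorder.* By the central limit theorem and Chebyshev's inequality, with probability close
to one the disorder is favourable for one of the two phases, and the walk is positive with
asymptotic probability `1/2`. Finitely many steps do not matter for the sign of the walk, so that
this sign is asymptotically independent of the disorder (`tendsto_setIntegral_fluctuation_pos`).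
By dominated convergence, `∫ Ξ(μ_n[η], η)` converges to `½ ∫ Ξ(μ_ν̂₁[η], η) + ½ ∫ Ξ(μ_ν̂₂[η], η)`
(`tendsto_integral_gibbs`).

This identifies the limit `J`, as probability measures are determined by the integrals of bounded
continuous functions. Here the `σ`-algebra on `ProbabilityMeasure (ℕ → E)` generated by the
evaluation maps has to be the Borel `σ`-algebra (`borelSpace_probabilityMeasure`). The conditional
distribution is then almost surely unique, since this `σ`-algebra is countably generated.
-/

namespace MeanField

/-! ### Probability measures on a sequence space with a finite alphabet -/

section SequenceSpace

variable {E E' : Type*}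

/-- The cylinder sets of `ℕ → E`. -/
def cylinders (E : Type*) : Set (Set (ℕ → E)) :=
  {s | ∃ (x : ℕ → E) (k : ℕ), s = PiNat.cylinder x k}

lemma isPiSystem_cylinders : IsPiSystem (cylinders E) := by
  rintro _ ⟨x, k, rfl⟩ _ ⟨y, m, rfl⟩ ⟨z, hzx, hzy⟩
  refine ⟨z, max k m, ?_⟩
  ext ω
  simp only [Set.mem_inter_iff, PiNat.mem_cylinder_iff] at *
  constructor
  · rintro ⟨h1, h2⟩ i hi
    rcases lt_max_iff.1 hi with h | h
    · rw [h1 i h, hzx i h]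
    · rw [h2 i h, hzy i h]
  · intro h
    exact ⟨fun i hi => by rw [h i (lt_max_of_lt_left hi), hzx i hi],
      fun i hi => by rw [h i (lt_max_of_lt_right hi), hzy i hi]⟩

variable [TopologicalSpace E] [DiscreteTopology E]

lemma isClopen_cylinder (x : ℕ → E) (k : ℕ) : IsClopen (PiNat.cylinder x k) := by
  refine ⟨?_, PiNat.isOpen_cylinder _ x k⟩
  have : PiNat.cylinder x k = ⋂ i ∈ Finset.range k, (fun ω : ℕ → E => ω i) ⁻¹' {x i} := by
    ext ω
    simp [PiNat.mem_cylinder_iff]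
  rw [this]
  exact isClosed_biInter fun i _ => isClosed_singleton.preimage (continuous_apply i)

variable [Fintype E] [MeasurableSpace E] [MeasurableSingletonClass E]

lemma measurableSet_cylinder (x : ℕ → E) (k : ℕ) : MeasurableSet (PiNat.cylinder x k) :=
  (isClopen_cylinder x k).isOpen.measurableSet

lemma generateFrom_cylinders :
    (inferInstance : MeasurableSpace (ℕ → E)) = MeasurableSpace.generateFrom (cylinders E) := by
  rw [BorelSpace.measurable_eq (α := ℕ → E)]
  exact (PiNat.isTopologicalBasis_cylinders fun _ => E).borel_eq_generateFrom

/-- Weak convergence of probability measures on `ℕ → E` follows from convergence of the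
probabilities of the cylinder sets. -/
lemma tendsto_of_tendsto_cylinder {ι : Type*} {l : Filter ι} [l.IsCountablyGenerated]
    {μ : ι → ProbabilityMeasure (ℕ → E)} {ν : ProbabilityMeasure (ℕ → E)}
    (h : ∀ x k, Tendsto (fun i => (μ i : Measure (ℕ → E)).real (PiNat.cylinder x k)) l
      (𝓝 ((ν : Measure (ℕ → E)).real (PiNat.cylinder x k)))) : Tendsto μ l (𝓝 ν) := by
  refine isPiSystem_cylinders.tendsto_probabilityMeasure_of_tendsto_of_mem ?_ ?_ ?_
  · rintro _ ⟨x, k, rfl⟩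
    exact measurableSet_cylinder x k
  · intro u hu x hx
    obtain ⟨s, hs, hxs, hsu⟩ :=
      (PiNat.isTopologicalBasis_cylinders fun _ => E).exists_subset_of_mem_open hx hu
    refine ⟨s, hs, ?_, hsu⟩
    obtain ⟨y, k, rfl⟩ := hs
    exact (PiNat.isOpen_cylinder _ y k).mem_nhds hxs
  · rintro _ ⟨x, k, rfl⟩
    exact NNReal.tendsto_coe.1 (h x k)

lemma continuous_measureReal_cylinder (x : ℕ → E) (k : ℕ) :
    Continuous fun μ : ProbabilityMeasure (ℕ → E) =>
      (μ : Measure (ℕ → E)).real (PiNat.cylinder x k) := by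
  refine continuous_iff_continuousAt.2 fun μ => ?_
  exact NNReal.tendsto_coe.2 (ProbabilityMeasure.tendsto_measure_of_isClopen_of_tendsto
    tendsto_id (isClopen_cylinder x k))

/-- The `σ`-algebra generated by the evaluation maps is the Borel `σ`-algebra of the weak topology:
the countably many probabilities of cylinders embed this compact space into a countable power
of `ℝ`. -/
instance borelSpace_probabilityMeasure [Nonempty E] :
    BorelSpace (ProbabilityMeasure (ℕ → E)) := by
  refine ⟨le_antisymm ?_ ?_⟩
  · have h : @Measurable _ _ (borel (ProbabilityMeasure (ℕ → E))) _
        (fun μ : ProbabilityMeasure (ℕ → E) => (μ : Measure (ℕ → E))) := by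
      let : MeasurableSpace (ProbabilityMeasure (ℕ → E)) := borel _
      have : BorelSpace (ProbabilityMeasure (ℕ → E)) := ⟨rfl⟩
      refine Measurable.measure_of_isPiSystem_of_isProbabilityMeasure generateFrom_cylinders
        isPiSystem_cylinders ?_
      rintro _ ⟨x, k, rfl⟩
      convert (continuous_measureReal_cylinder x k).measurable.ennreal_ofReal with μ
      exact (ofReal_measureReal (measure_ne_top _ _)).symm
    exact measurable_iff_comap_le.1 h
  · let y : (Σ k : ℕ, Fin k → E) → ℕ → E := fun c i =>
      if h : i < c.1 then c.2 ⟨i, h⟩ else Classical.arbitrary E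
    let e : ProbabilityMeasure (ℕ → E) → (Σ k : ℕ, Fin k → E) → ℝ := fun μ c =>
      (μ : Measure (ℕ → E)).real (PiNat.cylinder (y c) c.1)
    have he : IsClosedEmbedding e := by
      refine Continuous.isClosedEmbedding
        (continuous_pi fun c => continuous_measureReal_cylinder _ _) fun μ ν h => ?_
      refine tendsto_nhds_unique (tendsto_const_nhds (f := (atTop : Filter ℕ)) (x := μ))
        (tendsto_of_tendsto_cylinder fun x k => ?_)
      have hxy : PiNat.cylinder (y ⟨k, fun i => x i⟩) k = PiNat.cylinder x k := by
        ext ω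
        simp only [PiNat.mem_cylinder_iff, y]
        exact forall₂_congr fun i hi => by simp [hi]
      have := congrFun h ⟨k, fun i => x i⟩
      simp only [e, hxy] at this
      rw [this]
      exact tendsto_const_nhds
    have hm : Measurable e := by
      refine measurable_pi_lambda _ fun c => ?_
      exact ((Measure.measurable_coe (measurableSet_cylinder _ _)).comp
        measurable_subtype_coe).ennreal_toReal
    have hb : borel (ProbabilityMeasure (ℕ → E)) = MeasurableSpace.comap e inferInstance := by
      rw [BorelSpace.measurable_eq (α := (Σ k : ℕ, Fin k → E) → ℝ), ← borel_comap,
        ← he.isInducing.eq_induced]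
    rw [hb]
    exact measurable_iff_comap_le.1 hm

/-- A map into the probability measures on `ℕ → E` such that each cylinder probability depends on
finitely many coordinates only is continuous. -/
lemma continuous_of_cylinder_dependsOn [TopologicalSpace E'] [DiscreteTopology E']
    {f : (ℕ → E') → ProbabilityMeasure (ℕ → E)}
    (h : ∀ x k, ∃ m : ℕ, ∀ η η' : ℕ → E', (∀ i < m, η i = η' i) →
      (f η : Measure (ℕ → E)).real (PiNat.cylinder x k) =
        (f η' : Measure (ℕ → E)).real (PiNat.cylinder x k)) : Continuous f := by
  refine continuous_iff_continuousAt.2 fun η => ?_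
  refine tendsto_of_tendsto_cylinder fun x k => ?_
  obtain ⟨m, hm⟩ := h x k
  refine tendsto_const_nhds.congr' ?_
  filter_upwards [(PiNat.isOpen_cylinder (fun _ => E') η m).mem_nhds
    (PiNat.self_mem_cylinder η m)] with η' hη'
  exact hm η η' fun i hi => (PiNat.mem_cylinder_iff.1 hη' i hi).symm

end SequenceSpace

/-! ### Product measures and finite volume Gibbs measures as finite sums -/

section FiniteSums

variable {E E' : Type*} [Fintype E]

lemma sum_prod_eq_prod_sum {n : ℕ} (g : Fin n → E → ℝ) :
    ∑ σ : Fin n → E, ∏ i, g i (σ i) = ∏ i, ∑ a, g i a := by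
  classical
  rw [Finset.prod_univ_sum, Fintype.piFinset_univ]

section Moments

variable {n : ℕ} {q : Fin n → E → ℝ}

lemma sum_prod_eq_one (hq1 : ∀ i, ∑ a, q i a = 1) : ∑ σ : Fin n → E, ∏ i, q i (σ i) = 1 := by
  rw [sum_prod_eq_prod_sum]
  simp [hq1]

/-- The marginal at one site of a product of probability vectors. -/
lemma sum_prod_mul_single (hq1 : ∀ i, ∑ a, q i a = 1) (j : Fin n) (f : E → ℝ) :
    ∑ σ : Fin n → E, (∏ i, q i (σ i)) * f (σ j) = ∑ a, q j a * f a := by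
  have h (σ : Fin n → E) : (∏ i, q i (σ i)) * f (σ j) =
      ∏ i, (q i (σ i) * if i = j then f (σ i) else 1) := by
    rw [Finset.prod_mul_distrib]
    simp
  simp_rw [h]
  rw [sum_prod_eq_prod_sum fun i a => q i a * if i = j then f a else 1,
    ← Finset.mul_prod_erase _ _ (Finset.mem_univ j)]
  rw [Finset.prod_eq_one fun i hi => by simp [Finset.ne_of_mem_erase hi, hq1]]
  simp

lemma sum_prod_mul_sum (hq1 : ∀ i, ∑ a, q i a = 1) (f : Fin n → E → ℝ) :
    ∑ σ : Fin n → E, (∏ i, q i (σ i)) * ∑ j, f j (σ j) = ∑ j, ∑ a, q j a * f j a := by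
  simp_rw [Finset.mul_sum]
  rw [Finset.sum_comm]
  exact Finset.sum_congr rfl fun j _ => sum_prod_mul_single hq1 j (f j)

/-- A sum of `n` independent centred variables bounded by `C` has second moment at most `n * C²`. -/
lemma sum_prod_mul_sq_le (hq0 : ∀ i a, 0 ≤ q i a) (hq1 : ∀ i, ∑ a, q i a = 1)
    {f : Fin n → E → ℝ} (hf : ∀ i, ∑ a, q i a * f i a = 0) {C : ℝ} (hC : ∀ i a, |f i a| ≤ C) :
    ∑ σ : Fin n → E, (∏ i, q i (σ i)) * (∑ i, f i (σ i)) ^ 2 ≤ n * C ^ 2 := by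
  have hcross (i j : Fin n) (hij : i ≠ j) :
      ∑ σ : Fin n → E, (∏ l, q l (σ l)) * (f i (σ i) * f j (σ j)) = 0 := by
    have h (σ : Fin n → E) : (∏ l, q l (σ l)) * (f i (σ i) * f j (σ j)) =
        ∏ l, (q l (σ l) * ((if l = i then f l (σ l) else 1) *
          (if l = j then f l (σ l) else 1))) := by
      rw [Finset.prod_mul_distrib, Finset.prod_mul_distrib]
      simp
    simp_rw [h]
    rw [sum_prod_eq_prod_sum fun l a => q l a * ((if l = i then f l a else 1) *
      (if l = j then f l a else 1))]
    refine Finset.prod_eq_zero (Finset.mem_univ i) ?_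
    simpa [hij] using hf i
  simp_rw [sq, Finset.sum_mul_sum, Finset.mul_sum]
  rw [Finset.sum_comm]
  have hrow (i : Fin n) : ∑ σ : Fin n → E, ∑ j, (∏ l, q l (σ l)) * (f i (σ i) * f j (σ j)) ≤
      C * C := by
    rw [Finset.sum_comm, Finset.sum_eq_single i (fun j _ hj => hcross i j hj.symm) (by simp),
      sum_prod_mul_single hq1 i fun a => f i a * f i a]
    calc ∑ a, q i a * (f i a * f i a) ≤ ∑ a, q i a * (C * C) := by
          refine Finset.sum_le_sum fun a _ => mul_le_mul_of_nonneg_left ?_ (hq0 i a)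
          have := abs_le.1 (hC i a)
          nlinarith
      _ = C * C := by rw [← Finset.sum_mul, hq1, one_mul]
  calc _ ≤ ∑ _i : Fin n, C * C := Finset.sum_le_sum fun i _ => hrow i
    _ = n * (C * C) := by simp

end Moments

lemma cylinder_eq_setOf_forall_fin {E : Type*} (x : ℕ → E) (k : ℕ) :
    PiNat.cylinder x k = {ω : ℕ → E | ∀ i : Fin k, ω i = x i} := by
  ext ω
  simp only [PiNat.mem_cylinder_iff, Set.mem_ofPred_eq]
  exact ⟨fun h i => h i i.2, fun h i hi => h ⟨i, hi⟩⟩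

section Laws

variable [MeasurableSpace E] [MeasurableSingletonClass E]

lemma measureReal_law_singleton (p : stdSimplex ℝ E) (a : E) : (law p).real {a} = p a := by
  classical
  have h0 : ∀ a, 0 ≤ p a := p.2.1
  simp only [law, Measure.real, Measure.coe_finsetSum, Finset.sum_apply, Measure.smul_apply,
    smul_eq_mul, Measure.dirac_apply' _ (measurableSet_singleton a)]
  simp [Set.indicator_apply, h0]

lemma measureReal_infinitePi_law_eq (q : ℕ → stdSimplex ℝ E) {n : ℕ} (σ : Fin n → E) :
    (Measure.infinitePi fun i => law (q i)).real {ω | ∀ i : Fin n, ω i = σ i} =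
      ∏ i : Fin n, q i (σ i) := by
  have hset : {ω : ℕ → E | ∀ i : Fin n, ω i = σ i} =
      Set.pi (Finset.range n) fun i => if h : i < n then {σ ⟨i, h⟩} else Set.univ := by
    ext ω
    simp only [Set.mem_ofPred_eq, Set.mem_pi, Finset.coe_range, Set.mem_Iio]
    exact ⟨fun h i hi => by simpa [hi] using h ⟨i, hi⟩,
      fun h i => by simpa using h i i.2⟩
  rw [hset, Measure.real, Measure.infinitePi_pi _ fun i _ => Set.Finite.measurableSet
    (Set.toFinite _), ENNReal.toReal_prod, Finset.prod_range]
  refine Finset.prod_congr rfl fun i _ => ?_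
  simp only [Fin.is_lt, dite_true, Fin.eta]
  exact measureReal_law_singleton (q i) (σ i)

lemma measurable_initial {E : Type*} [MeasurableSpace E] (n : ℕ) :
    Measurable fun (ω : ℕ → E) (i : Fin n) => ω i :=
  measurable_pi_lambda _ fun _ => measurable_pi_apply _

lemma integral_infinitePi_law (q : ℕ → stdSimplex ℝ E) {n : ℕ} (g : (Fin n → E) → ℝ) :
    ∫ ω, g (fun i => ω i) ∂(Measure.infinitePi fun i => law (q i)) =
      ∑ σ : Fin n → E, (∏ i : Fin n, q i (σ i)) * g σ := by
  have hg : Measurable g := measurable_of_countable g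
  rw [← integral_map (measurable_initial n).aemeasurable hg.aestronglyMeasurable,
    integral_fintype Integrable.of_finite]
  refine Finset.sum_congr rfl fun σ _ => ?_
  rw [map_measureReal_apply (measurable_initial n) (measurableSet_singleton σ), smul_eq_mul,
    ← measureReal_infinitePi_law_eq]
  congr 2
  ext ω
  simp [funext_iff]

lemma integral_aPriori [Nonempty E] (α : E' → stdSimplex ℝ E) (n : ℕ) (η : ℕ → E')
    (g : (Fin n → E) → ℝ) :
    ∫ ω, g (fun i => ω i) ∂aPriori α n η =
      ∑ σ : Fin n → E, (∏ i : Fin n, α (η i) (σ i)) * g σ := by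
  rw [aPriori, integral_infinitePi_law]
  simp

end Laws

section EmpiricalMeasure

variable {E : Type*} [DecidableEq E]

/-- The empirical measure `(1/n) ∑ δ_{σ(i)}` of a finite sequence. -/
noncomputable def empiricalMeasure {n : ℕ} (σ : Fin n → E) : E → ℝ :=
  (n : ℝ)⁻¹ • ∑ i, Pi.single (σ i) 1

lemma empirical_eq_empiricalMeasure (n : ℕ) (ω : ℕ → E) :
    empirical n ω = empiricalMeasure fun i : Fin n => ω i := by
  simp only [empirical, empiricalMeasure, Finset.sum_range]

lemma empiricalMeasure_apply {n : ℕ} (σ : Fin n → E) (a : E) :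
    empiricalMeasure σ a = (n : ℝ)⁻¹ * ∑ i, if σ i = a then 1 else 0 := by
  simp [empiricalMeasure, Pi.single_apply, eq_comm]

variable [Fintype E]

/-- Sums along a sequence are integrals against its empirical measure. -/
lemma sum_eq_mul_sum_empiricalMeasure {n : ℕ} (hn : n ≠ 0) (σ : Fin n → E) (f : E → ℝ) :
    ∑ i, f (σ i) = n * ∑ a, empiricalMeasure σ a * f a := by
  have hn' : (n : ℝ) ≠ 0 := Nat.cast_ne_zero.2 hn
  simp_rw [empiricalMeasure_apply, mul_assoc, ← Finset.mul_sum, mul_inv_cancel_left₀ hn',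
    Finset.sum_mul]
  rw [Finset.sum_comm]
  simp

lemma empiricalMeasure_mem_stdSimplex {n : ℕ} (hn : n ≠ 0) (σ : Fin n → E) :
    empiricalMeasure σ ∈ stdSimplex ℝ E := by
  have hn' : (n : ℝ) ≠ 0 := Nat.cast_ne_zero.2 hn
  refine ⟨fun a => ?_, ?_⟩
  · rw [empiricalMeasure_apply]
    positivity
  · have := sum_eq_mul_sum_empiricalMeasure hn σ fun _ => 1
    simp only [Finset.sum_const, Finset.card_univ, Fintype.card_fin, nsmul_eq_mul, mul_one] at this
    exact (mul_right_eq_self₀.1 this.symm).resolve_right hn'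

end EmpiricalMeasure

section Gibbs

variable [DecidableEq E]

/-- The unnormalized Gibbs weight `exp(- n F(L_n)) ∏ α[b(i)](σ(i))` of a configuration. -/
noncomputable def boltzmannWeight (F : (E → ℝ) → ℝ) (α : E' → stdSimplex ℝ E) {n : ℕ}
    (b : Fin n → E') (σ : Fin n → E) : ℝ :=
  (∏ i, α (b i) (σ i)) * Real.exp (-(n * F (empiricalMeasure σ)))

/-- The partition function `Z_n`. -/
noncomputable def partitionFunction (F : (E → ℝ) → ℝ) (α : E' → stdSimplex ℝ E) {n : ℕ}
    (b : Fin n → E') : ℝ :=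
  ∑ σ, boltzmannWeight F α b σ

lemma boltzmannWeight_nonneg (F : (E → ℝ) → ℝ) (α : E' → stdSimplex ℝ E) {n : ℕ}
    (b : Fin n → E') (σ : Fin n → E) : 0 ≤ boltzmannWeight F α b σ :=
  mul_nonneg (Finset.prod_nonneg fun i _ => (α (b i)).2.1 _) (Real.exp_pos _).le

variable [MeasurableSpace E] [MeasurableSingletonClass E] [Nonempty E]

/-- The Gibbs probability of a cylinder of length `k ≤ n`, as a quotient of finite sums. -/
lemma gibbs_real_cylinder (F : (E → ℝ) → ℝ) (α : E' → stdSimplex ℝ E) (k m : ℕ) (η : ℕ → E')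
    (x : ℕ → E) :
    (gibbs F α (k + m) η : Measure (ℕ → E)).real (PiNat.cylinder x k) =
      (∑ τ : Fin m → E, boltzmannWeight F α (fun i : Fin (k + m) => η i)
        (Fin.append (fun i => x i) τ)) /
        partitionFunction F α (fun i : Fin (k + m) => η i) := by
  have hms : MeasurableSet (PiNat.cylinder x k) := by
    rw [cylinder_eq_setOf_forall_fin, show {ω : ℕ → E | ∀ i : Fin k, ω i = x i} =
      (fun ω (i : Fin k) => ω i) ⁻¹' {fun i : Fin k => x i} by ext; simp [funext_iff]]
    exact measurable_initial k (measurableSet_singleton _)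
  have hZ : ∫ ω, Real.exp (-((k + m : ℕ) * F (empirical (k + m) ω))) ∂aPriori α (k + m) η =
      partitionFunction F α (fun i : Fin (k + m) => η i) := by
    simp_rw [empirical_eq_empiricalMeasure]
    exact integral_aPriori α (k + m) η fun σ => Real.exp (-((k + m : ℕ) * F (empiricalMeasure σ)))
  let g : (Fin (k + m) → E) → ℝ := fun σ =>
    Real.exp (-((k + m : ℕ) * F (empiricalMeasure σ))) /
      partitionFunction F α (fun i : Fin (k + m) => η i) *
      if ∀ i : Fin (k + m), (i : ℕ) < k → σ i = x i then 1 else 0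
  have hI : (gibbs F α (k + m) η : Measure (ℕ → E)).real (PiNat.cylinder x k) =
      ∫ ω, g (fun i => ω i) ∂aPriori α (k + m) η := by
    rw [← integral_indicator_one hms]
    rw [show (gibbs F α (k + m) η : Measure (ℕ → E)) = (aPriori α (k + m) η).tilted
      fun ω => -((k + m : ℕ) * F (empirical (k + m) ω)) from rfl, integral_tilted, hZ]
    refine integral_congr_ae (ae_of_all _ fun ω => ?_)
    have hiff : ω ∈ PiNat.cylinder x k ↔ ∀ i : Fin (k + m), (i : ℕ) < k → ω i = x i := by
      rw [PiNat.mem_cylinder_iff]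
      exact ⟨fun h i hi => h i hi, fun h i hi => h ⟨i, by omega⟩ hi⟩
    simp only [smul_eq_mul, empirical_eq_empiricalMeasure]
    by_cases hω : ω ∈ PiNat.cylinder x k
    · simp only [g, Set.indicator_of_mem hω, if_pos (hiff.1 hω), Pi.one_apply]
    · simp only [g, Set.indicator_of_notMem hω, if_neg fun h => hω (hiff.2 h)]
  rw [hI, integral_aPriori, ← (Fin.appendEquiv k m).sum_comp, Fintype.sum_prod_type,
    Finset.sum_eq_single fun i : Fin k => x i, Finset.sum_div]
  · refine Finset.sum_congr rfl fun τ _ => ?_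
    have : ∀ i : Fin (k + m), (i : ℕ) < k →
        Fin.append (fun i : Fin k => x i) τ i = x i := by
      intro i hi
      have : i = Fin.castAdd m ⟨i, hi⟩ := rfl
      rw [this, Fin.append_left]
      rfl
    change _ * g (Fin.append _ τ) = _
    simp only [g, boltzmannWeight]
    rw [if_pos this]
    simp only [Fin.appendEquiv_apply]
    ring
  · intro a _ ha
    refine Finset.sum_eq_zero fun τ _ => ?_
    have : ¬ ∀ i : Fin (k + m), (i : ℕ) < k → Fin.append a τ i = x i := by
      intro h
      refine ha (funext fun i => ?_)
      simpa using h (Fin.castAdd m i) i.2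
    change _ * g (Fin.append a τ) = 0
    simp only [g]
    rw [if_neg this]
    simp
  · simp

end Gibbs

end FiniteSums

/-! ### First order expansions of the free energy -/

section Expansion

variable {E E' : Type*} [Fintype E] [Fintype E']

/-- The simplex has empty interior in `E → ℝ`, so a derivative within it is not unique, but its
values on differences of points of the simplex are. -/
lemma dF_sub_eq {F : (E → ℝ) → ℝ} {φ : (E → ℝ) →L[ℝ] ℝ} {x y : E → ℝ}
    (h : HasFDerivWithinAt F φ (stdSimplex ℝ E) x) (hx : x ∈ stdSimplex ℝ E)
    (hy : y ∈ stdSimplex ℝ E) : φ (y - x) = dF F x (y - x) :=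
  h.unique_on h.differentiableWithinAt.hasFDerivWithinAt
    (mem_tangentConeAt_of_segment_subset ((convex_stdSimplex ℝ E).segment_subset hx hy))

/-- A continuously differentiable function on the simplex is strictly differentiable along the
simplex. -/
lemma exists_abs_sub_sub_dF_le {F : (E → ℝ) → ℝ} (hF : ContDiffOn ℝ 2 F (stdSimplex ℝ E))
    {x : E → ℝ} (hx : x ∈ stdSimplex ℝ E) {ε : ℝ} (hε : 0 < ε) :
    ∃ r > 0, ∀ y ∈ stdSimplex ℝ E, ∀ z ∈ stdSimplex ℝ E, ‖y - x‖ < r → ‖z - x‖ < r →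
      |F z - F y - dF F x (z - y)| ≤ ε * ‖z - y‖ := by
  have h1 : ContDiffWithinAt ℝ (0 + 1) F (stdSimplex ℝ E) x :=
    (hF x hx).of_le (by norm_num)
  obtain ⟨u, hu, -, -, f', hf', hcont⟩ :=
    (contDiffWithinAt_succ_iff_hasFDerivWithinAt' (by simp)).1 h1
  rw [Set.insert_eq_of_mem hx] at hu
  have hev : ∀ᶠ y in 𝓝[stdSimplex ℝ E] x, y ∈ u ∧ ‖f' y - f' x‖ ≤ ε := by
    refine Filter.Eventually.and hu ?_
    have := hcont.continuousWithinAt.eventually (Metric.closedBall_mem_nhds (f' x) hε)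
    simpa [dist_eq_norm] using this
  obtain ⟨r, hr, hball⟩ := Metric.mem_nhdsWithin_iff.1 hev
  refine ⟨r, hr, fun y hy z hz hyr hzr => ?_⟩
  have hconv : Convex ℝ (Metric.ball x r ∩ stdSimplex ℝ E) :=
    (convex_ball x r).inter (convex_stdSimplex ℝ E)
  have hmv := hconv.norm_image_sub_le_of_norm_hasFDerivWithin_le' (f := F) (f' := f') (φ := f' x)
    (C := ε) (x := y) (y := z)
    (fun w hw => (hf' w (hball hw).1).mono Set.inter_subset_right)
    (fun w hw => (hball hw).2) ⟨by simpa [dist_eq_norm] using hyr, hy⟩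
    ⟨by simpa [dist_eq_norm] using hzr, hz⟩
  have hxx := (hball ⟨Metric.mem_ball_self hr, hx⟩).1
  have hd : f' x (z - y) = dF F x (z - y) := by
    have e : z - y = (z - x) - (y - x) := by abel
    rw [e, map_sub _ (z - x), map_sub _ (z - x), dF_sub_eq (hf' x hxx) hx hz,
      dF_sub_eq (hf' x hxx) hx hy]
  rwa [hd, Real.norm_eq_abs] at hmv

lemma exists_forall_abs_le_of_contDiffOn {F : (E → ℝ) → ℝ}
    (hF : ContDiffOn ℝ 2 F (stdSimplex ℝ E)) :
    ∃ B, ∀ y ∈ stdSimplex ℝ E, |F y| ≤ B :=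
  (isCompact_stdSimplex ℝ E).exists_bound_of_continuousOn hF.continuousOn

/-- A version of strict differentiability at `x` in which the second point ranges over the whole
simplex, at the price of a quadratic term. -/
lemma exists_abs_sub_sub_dF_le_add_sq {F : (E → ℝ) → ℝ}
    (hF : ContDiffOn ℝ 2 F (stdSimplex ℝ E))
    {x : E → ℝ} (hx : x ∈ stdSimplex ℝ E) {ε : ℝ} (hε : 0 < ε) :
    ∃ r > 0, ∃ C ≥ 0, ∀ y ∈ stdSimplex ℝ E, ‖y - x‖ < r → ∀ z ∈ stdSimplex ℝ E,
      |F z - F y - dF F x (z - y)| ≤ ε * ‖z - y‖ + C * ‖z - y‖ ^ 2 := by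
  obtain ⟨r, hr, h⟩ := exists_abs_sub_sub_dF_le hF hx hε
  obtain ⟨B, hB⟩ := exists_forall_abs_le_of_contDiffOn hF
  have hB0 : 0 ≤ B := (abs_nonneg _).trans (hB x hx)
  refine ⟨r / 2, by positivity, 2 * B * (2 / r) ^ 2 + ‖dF F x‖ * (2 / r), by positivity,
    fun y hy hyr z hz => ?_⟩
  rcases lt_or_ge ‖z - x‖ r with hzr | hzr
  · have := h y hy z hz (by linarith) hzr
    have : 0 ≤ (2 * B * (2 / r) ^ 2 + ‖dF F x‖ * (2 / r)) * ‖z - y‖ ^ 2 := by positivity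
    linarith
  · have htri : ‖z - x‖ ≤ ‖z - y‖ + ‖y - x‖ := by
      simpa using norm_add_le (z - y) (y - x)
    have hzy : r / 2 ≤ ‖z - y‖ := by linarith
    have h1 : 1 ≤ 2 / r * ‖z - y‖ := by
      rw [div_mul_eq_mul_div, le_div_iff₀ hr]
      linarith
    have hdF : |dF F x (z - y)| ≤ ‖dF F x‖ * ‖z - y‖ := (dF F x).le_opNorm _
    have hz' := hB z hz
    have hy' := hB y hy
    have habs : |F z - F y - dF F x (z - y)| ≤ 2 * B + ‖dF F x‖ * ‖z - y‖ := by
      rw [abs_le] at *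
      constructor <;> linarith [hz'.1, hz'.2, hy'.1, hy'.2, hdF.1, hdF.2]
    have h2 : 2 * B ≤ 2 * B * (2 / r * ‖z - y‖) ^ 2 :=
      le_mul_of_one_le_right (by positivity) (one_le_pow₀ h1)
    have h3 : ‖dF F x‖ * ‖z - y‖ ≤ ‖dF F x‖ * ‖z - y‖ * (2 / r * ‖z - y‖) :=
      le_mul_of_one_le_right (by positivity) h1
    have h4 : 0 ≤ ε * ‖z - y‖ := by positivity
    calc _ ≤ 2 * B * (2 / r * ‖z - y‖) ^ 2 + ‖dF F x‖ * ‖z - y‖ * (2 / r * ‖z - y‖) := by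
          linarith
      _ ≤ _ := by linarith

/-! Elementary properties of mixtures and of the relative entropy. -/

omit [Fintype E] in
lemma mix_apply (x : E' → ℝ) (ν : E' → E → ℝ) (a : E) : mix x ν a = ∑ b, x b * ν b a := by
  simp [mix]

omit [Fintype E] in
lemma mix_sub_left (x y : E' → ℝ) (ν : E' → E → ℝ) : mix (x - y) ν = mix x ν - mix y ν := by
  simp [mix, sub_smul]

omit [Fintype E] in
lemma mix_sub_right (x : E' → ℝ) (ν ν' : E' → E → ℝ) : mix x (ν - ν') = mix x ν - mix x ν' := by
  simp [mix, smul_sub]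

lemma norm_mix_le (x : E' → ℝ) (ν : E' → E → ℝ) :
    ‖mix x ν‖ ≤ Fintype.card E' * ‖x‖ * ‖ν‖ := by
  calc ‖mix x ν‖ ≤ ∑ b, ‖x b • ν b‖ := norm_sum_le _ _
    _ ≤ ∑ _b : E', ‖x‖ * ‖ν‖ := by
        refine Finset.sum_le_sum fun b _ => ?_
        rw [norm_smul]
        exact mul_le_mul (norm_le_pi_norm x b) (norm_le_pi_norm ν b) (norm_nonneg _) (norm_nonneg _)
    _ = Fintype.card E' * ‖x‖ * ‖ν‖ := by simp [mul_assoc]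

omit [Fintype E] in
lemma continuous_mix : Continuous fun z : (E' → ℝ) × (E' → E → ℝ) => mix z.1 z.2 := by
  unfold mix
  fun_prop

lemma mix_mem_stdSimplex {p : E' → ℝ} (hp : p ∈ stdSimplex ℝ E') {ν : E' → E → ℝ}
    (hν : ∀ b, ν b ∈ stdSimplex ℝ E) : mix p ν ∈ stdSimplex ℝ E :=
  (convex_stdSimplex ℝ E).sum_mem (fun b _ => hp.1 b) hp.2 fun b _ => hν b

lemma norm_le_one_of_mem_stdSimplex {p : E → ℝ} (hp : p ∈ stdSimplex ℝ E) : ‖p‖ ≤ 1 := by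
  refine (pi_norm_le_iff_of_nonneg zero_le_one).2 fun a => ?_
  rw [Real.norm_eq_abs, abs_of_nonneg (hp.1 a), ← hp.2]
  exact Finset.single_le_sum (fun a _ => hp.1 a) (Finset.mem_univ a)

lemma continuous_relEntropy (q : E → ℝ) : Continuous fun p : E → ℝ => relEntropy p q := by
  unfold relEntropy
  refine continuous_finsetSum _ fun a _ => ?_
  rcases eq_or_ne (q a) 0 with h | h
  · simp only [h, div_zero, Real.log_zero, mul_zero]
    exact continuous_const
  · have : (fun p : E → ℝ => p a * Real.log (p a / q a)) =
        fun p => q a * (p a / q a * Real.log (p a / q a)) := by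
      funext p
      field_simp
    rw [this]
    have ha : Continuous fun p : E → ℝ => p a / q a := by fun_prop
    exact continuous_const.mul (Real.continuous_mul_log.comp ha)

variable {F : (E → ℝ) → ℝ} {α : E' → stdSimplex ℝ E} {π : stdSimplex ℝ E'}

omit [Fintype E'] in
lemma isCompact_finiteDomain (α : E' → stdSimplex ℝ E) : IsCompact (finiteDomain α) := by
  have h : finiteDomain α = (Set.univ.pi fun _ => stdSimplex ℝ E) ∩
      ⋂ (b) (a) (_ : α b a = 0), {ν | ν b a = 0} := by
    ext ν
    simp [finiteDomain]
  rw [h]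
  refine (isCompact_univ_pi fun _ => isCompact_stdSimplex ℝ E).inter_right ?_
  refine isClosed_iInter fun b => isClosed_iInter fun a => isClosed_iInter fun _ => ?_
  exact isClosed_eq (by fun_prop) continuous_const

lemma continuousOn_freeEnergy (hF : ContDiffOn ℝ 2 F (stdSimplex ℝ E)) :
    ContinuousOn (fun z : (E' → ℝ) × (E' → E → ℝ) => freeEnergy F α z.1 z.2)
      (stdSimplex ℝ E' ×ˢ finiteDomain α) := by
  unfold freeEnergy
  refine ContinuousOn.add ?_ (Continuous.continuousOn ?_)
  · exact hF.continuousOn.comp continuous_mix.continuousOn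
      fun z hz => mix_mem_stdSimplex hz.1 hz.2.1
  · refine continuous_finsetSum _ fun b _ => ?_
    exact ((continuous_apply b).comp continuous_fst).mul
      ((continuous_relEntropy _).comp ((continuous_apply b).comp continuous_snd))

/-- The gradient at `p = π` of `p ↦ Φ[p](ν̂)`, as a vector in `ℝ^E'`. The stability vector of `ν̂`
is minus this vector, acting on vectors of total mass zero. As `dF` is evaluated at the
probability vector `ν̂(b)`, this vector is meaningful up to an additive constant only, which such a
pairing ignores. -/
noncomputable def disorderGradient (F : (E → ℝ) → ℝ) (α : E' → stdSimplex ℝ E)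
    (π : stdSimplex ℝ E') (ν : E' → E → ℝ) (b : E') : ℝ :=
  dF F (mix π ν) (ν b) + relEntropy (ν b) (α b)

lemma sum_mul_disorderGradient (ν : E' → E → ℝ) (x : E' → ℝ) :
    ∑ b, x b * disorderGradient F α π ν b =
      dF F (mix π ν) (mix x ν) + ∑ b, x b * relEntropy (ν b) (α b) := by
  simp [disorderGradient, mix, mul_add, Finset.sum_add_distrib]

lemma stabilityVector_eq (ν : E' → E → ℝ) (x : {x : E' → ℝ // ∑ b, x b = 0}) :
    stabilityVector F α π ν x = -∑ b, x.1 b * disorderGradient F α π ν b := by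
  rw [sum_mul_disorderGradient, stabilityVector]

/-- Expansion of `Φ[p](ν̂)` in `p` around `π`, uniformly for `ν̂` close to `ν₀`. -/
lemma eventually_abs_freeEnergy_sub_le (hF : ContDiffOn ℝ 2 F (stdSimplex ℝ E))
    {ν₀ : E' → E → ℝ} (hν₀ : ν₀ ∈ finiteDomain α) {ε : ℝ} (hε : 0 < ε) :
    ∀ᶠ z : (E' → ℝ) × (E' → E → ℝ) in 𝓝 ((π : E' → ℝ), ν₀), z.1 ∈ stdSimplex ℝ E' →
      z.2 ∈ finiteDomain α →
      |freeEnergy F α z.1 z.2 - freeEnergy F α π z.2 -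
        ∑ b, (z.1 - π) b * disorderGradient F α π ν₀ b| ≤ ε * ‖z.1 - π‖ := by
  set c : ℝ := (Fintype.card E' : ℝ)
  have hc0 : 0 ≤ c := Nat.cast_nonneg _
  set x₀ := mix π ν₀ with hx₀
  have hx₀m : x₀ ∈ stdSimplex ℝ E := mix_mem_stdSimplex π.2 hν₀.1
  set ε' := ε / (3 * (c + 1)) with hε'
  have hε'0 : 0 < ε' := by positivity
  have hcε : c * ε' ≤ ε / 3 := by
    rw [hε', mul_div_assoc', div_le_div_iff₀ (by positivity) (by norm_num)]
    nlinarith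
  obtain ⟨r, hr, hS⟩ := exists_abs_sub_sub_dF_le hF hx₀m hε'0
  have e1 : ∀ᶠ z : (E' → ℝ) × (E' → E → ℝ) in 𝓝 ((π : E' → ℝ), ν₀), ‖mix z.1 z.2 - x₀‖ < r := by
    have h : ContinuousAt (fun z : (E' → ℝ) × (E' → E → ℝ) => ‖mix z.1 z.2 - x₀‖) (↑π, ν₀) :=
      ((continuous_mix.sub continuous_const).norm).continuousAt
    exact h.eventually_lt continuousAt_const (by simpa [hx₀] using hr)
  have e2 : ∀ᶠ z : (E' → ℝ) × (E' → E → ℝ) in 𝓝 ((π : E' → ℝ), ν₀), ‖mix π z.2 - x₀‖ < r := by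
    have h : ContinuousAt (fun z : (E' → ℝ) × (E' → E → ℝ) => ‖mix π z.2 - x₀‖) (↑π, ν₀) :=
      (((continuous_mix.comp (continuous_const.prodMk continuous_snd)).sub
        continuous_const).norm).continuousAt
    exact h.eventually_lt continuousAt_const (by simpa [hx₀] using hr)
  have e3 : ∀ᶠ z : (E' → ℝ) × (E' → E → ℝ) in 𝓝 ((π : E' → ℝ), ν₀),
      ‖dF F x₀‖ * (c * ‖z.2 - ν₀‖) < ε / 3 := by
    have h : ContinuousAt (fun z : (E' → ℝ) × (E' → E → ℝ) => ‖dF F x₀‖ * (c * ‖z.2 - ν₀‖))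
      (↑π, ν₀) := by fun_prop
    exact h.eventually_lt continuousAt_const (by simpa using hε)
  have e4 : ∀ᶠ z : (E' → ℝ) × (E' → E → ℝ) in 𝓝 ((π : E' → ℝ), ν₀),
      ∑ b, |relEntropy (z.2 b) (α b) - relEntropy (ν₀ b) (α b)| < ε / 3 := by
    have h : ContinuousAt (fun z : (E' → ℝ) × (E' → E → ℝ) =>
        ∑ b, |relEntropy (z.2 b) (α b) - relEntropy (ν₀ b) (α b)|) (↑π, ν₀) := by
      refine Continuous.continuousAt (continuous_finsetSum _ fun b _ => ?_)
      exact (((continuous_relEntropy _).comp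
        ((continuous_apply b).comp continuous_snd)).sub continuous_const).abs
    exact h.eventually_lt continuousAt_const (by simpa using hε)
  filter_upwards [e1, e2, e3, e4] with z h1 h2 h3 h4 hp hν
  set p := z.1
  set ν := z.2
  have hνn : ‖ν‖ ≤ 1 := (pi_norm_le_iff_of_nonneg zero_le_one).2
    fun b => norm_le_one_of_mem_stdSimplex (hν.1 b)
  have hA : |F (mix p ν) - F (mix π ν) - dF F x₀ (mix (p - ⇑π) ν)| ≤ ε / 3 * ‖p - π‖ := by
    rw [mix_sub_left]
    refine (hS _ (mix_mem_stdSimplex π.2 hν.1) _ (mix_mem_stdSimplex hp hν.1) h2 h1).trans ?_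
    rw [← mix_sub_left]
    calc ε' * ‖mix (p - ⇑π) ν‖ ≤ ε' * (c * ‖p - π‖ * ‖ν‖) := by gcongr; exact norm_mix_le _ _
      _ ≤ ε' * (c * ‖p - π‖ * 1) := by gcongr
      _ = c * ε' * ‖p - π‖ := by ring
      _ ≤ ε / 3 * ‖p - π‖ := by gcongr
  have hB : |dF F x₀ (mix (p - ⇑π) ν) - dF F x₀ (mix (p - ⇑π) ν₀)| ≤ ε / 3 * ‖p - π‖ := by
    rw [← map_sub, ← mix_sub_right]
    calc |dF F x₀ (mix (p - ⇑π) (ν - ν₀))| ≤ ‖dF F x₀‖ * ‖mix (p - ⇑π) (ν - ν₀)‖ :=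
          (dF F x₀).le_opNorm _
      _ ≤ ‖dF F x₀‖ * (c * ‖p - π‖ * ‖ν - ν₀‖) := by gcongr; exact norm_mix_le _ _
      _ = ‖dF F x₀‖ * (c * ‖ν - ν₀‖) * ‖p - π‖ := by ring
      _ ≤ ε / 3 * ‖p - π‖ := by gcongr
  have hC : |∑ b, (p - ⇑π) b * (relEntropy (ν b) (α b) - relEntropy (ν₀ b) (α b))| ≤
      ε / 3 * ‖p - π‖ := by
    calc _ ≤ ∑ b, ‖p - π‖ * |relEntropy (ν b) (α b) - relEntropy (ν₀ b) (α b)| := by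
          refine (Finset.abs_sum_le_sum_abs _ _).trans (Finset.sum_le_sum fun b _ => ?_)
          rw [abs_mul]
          gcongr
          exact norm_le_pi_norm (p - ⇑π) b
      _ = (∑ b, |relEntropy (ν b) (α b) - relEntropy (ν₀ b) (α b)|) * ‖p - π‖ := by
          rw [← Finset.mul_sum, mul_comm]
      _ ≤ ε / 3 * ‖p - π‖ := by gcongr
  have hsplit : freeEnergy F α p ν - freeEnergy F α π ν -
      ∑ b, (p - ⇑π) b * disorderGradient F α π ν₀ b =
      (F (mix p ν) - F (mix π ν) - dF F x₀ (mix (p - ⇑π) ν)) +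
      (dF F x₀ (mix (p - ⇑π) ν) - dF F x₀ (mix (p - ⇑π) ν₀)) +
      ∑ b, (p - ⇑π) b * (relEntropy (ν b) (α b) - relEntropy (ν₀ b) (α b)) := by
    rw [sum_mul_disorderGradient]
    simp only [freeEnergy, mul_sub, Finset.sum_sub_distrib, Pi.sub_apply, sub_mul]
    ring
  rw [hsplit]
  calc _ ≤ ε / 3 * ‖p - π‖ + ε / 3 * ‖p - π‖ + ε / 3 * ‖p - π‖ :=
        (abs_add_three _ _ _).trans (add_le_add (add_le_add hA hB) hC)
    _ = ε * ‖p - π‖ := by ring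

/-- If `ν₁` and `ν₂` are the only minimizers, then for `p` close to `π` the free energy `Φ[p]`, away
from configurations with mixture close to that of `ν₁`, is bounded below by the first order
expansion at `ν₂`: near `ν₂` this is the expansion itself, and elsewhere there is a gap. -/
lemma eventually_le_freeEnergy_of_far (hF : ContDiffOn ℝ 2 F (stdSimplex ℝ E))
    {ν₁ ν₂ : E' → E → ℝ} (hM : minimizers F α π = {ν₁, ν₂}) {ε r : ℝ} (hε : 0 < ε) (hr : 0 < r) :
    ∀ᶠ p : E' → ℝ in 𝓝 (π : E' → ℝ), p ∈ stdSimplex ℝ E' → ∀ ν ∈ finiteDomain α,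
      r ≤ ‖mix p ν - mix π ν₁‖ →
      freeEnergy F α π ν₂ + ∑ b, (p - ⇑π) b * disorderGradient F α π ν₂ b - ε * ‖p - π‖ ≤
        freeEnergy F α p ν := by
  have hν₂ : ν₂ ∈ minimizers F α π := by simp [hM]
  suffices h : ∀ᶠ p : E' → ℝ in 𝓝 (π : E' → ℝ), ∀ ν ∈ finiteDomain α, p ∈ stdSimplex ℝ E' →
      ν ∈ finiteDomain α → r ≤ ‖mix p ν - mix π ν₁‖ →
      freeEnergy F α π ν₂ + ∑ b, (p - ⇑π) b * disorderGradient F α π ν₂ b - ε * ‖p - π‖ ≤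
        freeEnergy F α p ν by
    filter_upwards [h] with p hp hps ν hν using hp ν hν hps hν
  refine (isCompact_finiteDomain α).eventually_forall_of_forall_eventually fun ν₀ hν₀ => ?_
  by_cases h1 : ν₀ = ν₁
  · subst h1
    have h : ContinuousAt (fun z : (E' → ℝ) × (E' → E → ℝ) => ‖mix z.1 z.2 - mix π ν₀‖) (↑π, ν₀) :=
      ((continuous_mix.sub continuous_const).norm).continuousAt
    filter_upwards [h.eventually_lt continuousAt_const (show _ < r by simpa using hr)]
      with z hz _ _ hzr
    exact absurd hz (not_lt.2 hzr)
  by_cases h2 : ν₀ = ν₂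
  · subst h2
    filter_upwards [eventually_abs_freeEnergy_sub_le hF (π := π) hν₂.1 hε] with z hz hp hν _
    have := (abs_le.1 (hz hp hν)).1
    have := hν₂.2 z.2 hν
    linarith
  · have hgap : freeEnergy F α π ν₂ < freeEnergy F α π ν₀ := by
      refine lt_of_le_of_ne (hν₂.2 ν₀ hν₀) fun h => ?_
      have : ν₀ ∈ minimizers F α π := ⟨hν₀, fun ν hν => h ▸ hν₂.2 ν hν⟩
      rw [hM] at this
      rcases this with h | h
      · exact h1 h
      · exact h2 h
    have hL : ContinuousWithinAt (fun z : (E' → ℝ) × (E' → E → ℝ) =>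
        freeEnergy F α π ν₂ + ∑ b, (z.1 - π) b * disorderGradient F α π ν₂ b - ε * ‖z.1 - π‖)
        (stdSimplex ℝ E' ×ˢ finiteDomain α) (↑π, ν₀) := by
      apply Continuous.continuousWithinAt
      fun_prop
    have hR := (continuousOn_freeEnergy (α := α) hF) (↑π, ν₀) ⟨π.2, hν₀⟩
    have := hL.eventually_lt hR (by simpa using hgap)
    rw [eventually_nhdsWithin_iff] at this
    filter_upwards [this] with z hz hp hν _
    exact (hz ⟨hp, hν⟩).le

end Expansion

/-! ### Bounds on partition sums -/

section PartitionBounds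

variable {E E' : Type*} [Fintype E] [Fintype E'] [DecidableEq E] [DecidableEq E']
  {F : (E → ℝ) → ℝ} {α : E' → stdSimplex ℝ E} {n : ℕ}

omit [Fintype E'] [DecidableEq E'] in
/-- Jensen's inequality for the partition function, after a change of the a priori measure to the
product of the probability vectors `ν(b(i))`. -/
lemma exp_le_partitionFunction {ν : E' → E → ℝ} (hν : ν ∈ finiteDomain α) (b : Fin n → E') :
    Real.exp (-∑ σ : Fin n → E, (∏ i, ν (b i) (σ i)) * (n * F (empiricalMeasure σ)) -
      ∑ i, relEntropy (ν (b i)) (α (b i))) ≤ partitionFunction F α b := by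
  let h : (Fin n → E) → ℝ := fun σ =>
    -(n * F (empiricalMeasure σ)) - ∑ i, Real.log (ν (b i) (σ i) / α (b i) (σ i))
  have hq0 (σ : Fin n → E) : 0 ≤ ∏ i, ν (b i) (σ i) :=
    Finset.prod_nonneg fun i _ => (hν.1 (b i)).1 _
  have hq1 : ∀ i, ∑ a, ν (b i) a = 1 := fun i => (hν.1 (b i)).2
  have hmean : ∑ σ : Fin n → E, (∏ i, ν (b i) (σ i)) • h σ =
      -∑ σ : Fin n → E, (∏ i, ν (b i) (σ i)) * (n * F (empiricalMeasure σ)) -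
      ∑ i, relEntropy (ν (b i)) (α (b i)) := by
    simp only [h, smul_eq_mul, mul_sub, Finset.sum_sub_distrib, mul_neg, Finset.sum_neg_distrib]
    rw [sum_prod_mul_sum (q := fun i => ν (b i)) hq1 fun i a =>
      Real.log (ν (b i) a / α (b i) a)]
    rfl
  rw [← hmean]
  refine (convexOn_exp.map_sum_le (fun σ _ => hq0 σ) (sum_prod_eq_one hq1)
    fun σ _ => Set.mem_univ _).trans (Finset.sum_le_sum fun σ _ => ?_)
  rcases (hq0 σ).eq_or_lt with h0 | hpos
  · rw [← h0, zero_smul]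
    exact boltzmannWeight_nonneg F α b σ
  · have hνpos (i : Fin n) : 0 < ν (b i) (σ i) :=
      lt_of_le_of_ne ((hν.1 (b i)).1 _)
        (Finset.prod_ne_zero_iff.1 hpos.ne' i (Finset.mem_univ i)).symm
    have hαpos (i : Fin n) : 0 < α (b i) (σ i) :=
      lt_of_le_of_ne ((α (b i)).2.1 _) fun h => (hνpos i).ne' (hν.2 _ _ h.symm)
    refine le_of_eq ?_
    simp only [h, boltzmannWeight, smul_eq_mul]
    rw [sub_eq_add_neg, Real.exp_add, ← Finset.sum_neg_distrib, Real.exp_sum, mul_comm (Real.exp _),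
      ← mul_assoc, ← Finset.prod_mul_distrib]
    congr 1
    refine Finset.prod_congr rfl fun i _ => ?_
    rw [Real.exp_neg, Real.exp_log (div_pos (hνpos i) (hαpos i)), inv_div,
      mul_div_cancel₀ _ (hνpos i).ne']

omit [Fintype E] [DecidableEq E] in
lemma sum_apply_eq_mul_mix_empiricalMeasure (hn : n ≠ 0) (ν : E' → E → ℝ) (b : Fin n → E') (a : E) :
    ∑ i, ν (b i) a = n * mix (empiricalMeasure b) ν a := by
  rw [mix_apply]
  exact sum_eq_mul_sum_empiricalMeasure hn b fun c => ν c a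

section ProductMeasure

variable {ν : E' → E → ℝ}

lemma sum_prod_mul_empiricalMeasure (hn : n ≠ 0) (hν : ∀ c, ν c ∈ stdSimplex ℝ E)
    (b : Fin n → E') (a : E) :
    ∑ σ : Fin n → E, (∏ i, ν (b i) (σ i)) * empiricalMeasure σ a =
      mix (empiricalMeasure b) ν a := by
  have hn' : (n : ℝ) ≠ 0 := Nat.cast_ne_zero.2 hn
  simp_rw [empiricalMeasure_apply, mul_left_comm _ (n : ℝ)⁻¹]
  rw [← Finset.mul_sum, sum_prod_mul_sum (q := fun i => ν (b i)) (fun i => (hν (b i)).2)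
    fun _ c => if c = a then 1 else 0]
  simp only [mul_ite, mul_one, mul_zero, Finset.sum_ite_eq', Finset.mem_univ, if_true]
  rw [sum_apply_eq_mul_mix_empiricalMeasure hn, inv_mul_cancel_left₀ hn']

/-- Under the product of the probability vectors `ν(b(i))`, the empirical measure has fluctuations
of order `n^(-1/2)` around its mean. -/
lemma sum_prod_mul_norm_sq_le (hn : n ≠ 0) (hν : ∀ c, ν c ∈ stdSimplex ℝ E) (b : Fin n → E') :
    ∑ σ : Fin n → E, (∏ i, ν (b i) (σ i)) *
      ‖empiricalMeasure σ - mix (empiricalMeasure b) ν‖ ^ 2 ≤ Fintype.card E / n := by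
  have hn' : (n : ℝ) ≠ 0 := Nat.cast_ne_zero.2 hn
  have hn0 : (0 : ℝ) < n := by positivity
  set m := mix (empiricalMeasure b) ν with hm
  have hq0 : ∀ i a, 0 ≤ ν (b i) a := fun i a => (hν (b i)).1 a
  have hq1 : ∀ i, ∑ a, ν (b i) a = 1 := fun i => (hν (b i)).2
  have hcoord (a : E) : ∑ σ : Fin n → E, (∏ i, ν (b i) (σ i)) *
      (empiricalMeasure σ a - m a) ^ 2 ≤ 1 / n := by
    have hdev (σ : Fin n → E) : empiricalMeasure σ a - m a =
        (n : ℝ)⁻¹ * ∑ i, ((if σ i = a then 1 else 0) - ν (b i) a) := by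
      rw [Finset.sum_sub_distrib, sum_apply_eq_mul_mix_empiricalMeasure hn, mul_sub,
        inv_mul_cancel_left₀ hn', empiricalMeasure_apply]
    have hle := sum_prod_mul_sq_le (q := fun i => ν (b i)) hq0 hq1
      (f := fun i c => (if c = a then 1 else 0) - ν (b i) a) (C := 1)
      (fun i => by simp [mul_sub, ← Finset.sum_mul, hq1]) (fun i c => by
        have h1 : ν (b i) a ≤ 1 := by
          rw [← hq1 i]
          exact Finset.single_le_sum (fun a _ => hq0 i a) (Finset.mem_univ a)
        have h0 := hq0 i a
        rw [abs_le]
        split_ifs <;> constructor <;> linarith)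
    simp_rw [hdev, mul_pow, mul_left_comm _ ((n : ℝ)⁻¹ ^ 2)]
    rw [← Finset.mul_sum]
    calc _ ≤ (n : ℝ)⁻¹ ^ 2 * (n * 1 ^ 2) := by gcongr
      _ = 1 / n := by field_simp
  have hnorm (v : E → ℝ) : ‖v‖ ^ 2 ≤ ∑ a, v a ^ 2 := by
    have h : ‖v‖ ≤ √(∑ a, v a ^ 2) := by
      refine (pi_norm_le_iff_of_nonneg (Real.sqrt_nonneg _)).2 fun a => ?_
      refine Real.le_sqrt_of_sq_le ?_
      rw [Real.norm_eq_abs, sq_abs]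
      exact Finset.single_le_sum (f := fun a => v a ^ 2) (fun a _ => sq_nonneg _)
        (Finset.mem_univ a)
    exact (Real.le_sqrt (norm_nonneg _) (Finset.sum_nonneg fun a _ => sq_nonneg _)).1 h
  calc _ ≤ ∑ σ : Fin n → E, (∏ i, ν (b i) (σ i)) * ∑ a, (empiricalMeasure σ a - m a) ^ 2 := by
        refine Finset.sum_le_sum fun σ _ => mul_le_mul_of_nonneg_left (hnorm _) ?_
        exact Finset.prod_nonneg fun i _ => hq0 i _
    _ = ∑ a, ∑ σ : Fin n → E, (∏ i, ν (b i) (σ i)) * (empiricalMeasure σ a - m a) ^ 2 := by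
        simp_rw [Finset.mul_sum]
        exact Finset.sum_comm
    _ ≤ ∑ _a : E, 1 / (n : ℝ) := Finset.sum_le_sum fun a _ => hcoord a
    _ = Fintype.card E / n := by simp [div_eq_mul_inv]

end ProductMeasure

/-- Lower bound on the partition function. The linear term in the expansion of `F` has mean zero
under the product measure of `exp_le_partitionFunction`, so that the error is `o(√n)`. -/
lemma exists_exp_le_partitionFunction (hF : ContDiffOn ℝ 2 F (stdSimplex ℝ E))
    (π : stdSimplex ℝ E') {ν : E' → E → ℝ} (hν : ν ∈ finiteDomain α) {ε : ℝ} (hε : 0 < ε) :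
    ∃ r > 0, ∃ C : ℝ, ∀ n : ℕ, n ≠ 0 → ∀ b : Fin n → E',
      ‖mix (empiricalMeasure b) ν - mix π ν‖ < r →
      Real.exp (-(n * freeEnergy F α (empiricalMeasure b) ν + ε * √n + C)) ≤
        partitionFunction F α b := by
  set c : ℝ := (Fintype.card E : ℝ)
  have hc0 : 0 ≤ c := Nat.cast_nonneg _
  set x := mix π ν
  obtain ⟨r, hr, C, hC, h⟩ := exists_abs_sub_sub_dF_le_add_sq hF (x := x)
    (mix_mem_stdSimplex π.2 hν.1) (show 0 < ε / (c + 1) by positivity)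
  refine ⟨r, hr, C * c, fun n hn b hb => le_trans (Real.exp_le_exp.2 ?_)
    (exp_le_partitionFunction hν b)⟩
  have hn' : (n : ℝ) ≠ 0 := Nat.cast_ne_zero.2 hn
  have hn0 : (0 : ℝ) < n := by positivity
  have hs0 : 0 < √(n : ℝ) := Real.sqrt_pos.2 hn0
  have hss : √(n : ℝ) * √n = n := Real.mul_self_sqrt hn0.le
  set p := empiricalMeasure b
  set m := mix p ν
  have hm : m ∈ stdSimplex ℝ E := mix_mem_stdSimplex (empiricalMeasure_mem_stdSimplex hn b) hν.1
  set Q : (Fin n → E) → ℝ := fun σ => ∏ i, ν (b i) (σ i)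
  have hQ0 (σ : Fin n → E) : 0 ≤ Q σ := Finset.prod_nonneg fun i _ => (hν.1 (b i)).1 _
  have hQ1 : ∑ σ, Q σ = 1 := sum_prod_eq_one fun i => (hν.1 (b i)).2
  have hS : ∑ i, relEntropy (ν (b i)) (α (b i)) = n * ∑ c, p c * relEntropy (ν c) (α c) :=
    sum_eq_mul_sum_empiricalMeasure hn b fun c => relEntropy (ν c) (α c)
  have hlin : ∑ σ, Q σ * dF F x (empiricalMeasure σ - m) = 0 := by
    have : ∑ σ, Q σ • (empiricalMeasure σ - m) = 0 := by
      funext a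
      simp only [Finset.sum_apply, Pi.smul_apply, Pi.sub_apply, smul_eq_mul, mul_sub,
        Finset.sum_sub_distrib, ← Finset.sum_mul, hQ1, one_mul, Pi.zero_apply]
      exact sub_eq_zero.2 (sum_prod_mul_empiricalMeasure hn hν.1 b a)
    have := congrArg (dF F x) this
    simpa only [map_sum, map_smul, smul_eq_mul, map_zero] using this
  have hvar : ∑ σ, Q σ * ‖empiricalMeasure σ - m‖ ^ 2 ≤ c / n := sum_prod_mul_norm_sq_le hn hν.1 b
  have hterm (σ : Fin n → E) : F (empiricalMeasure σ) ≤ F m + dF F x (empiricalMeasure σ - m) +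
      (ε / (c + 1) / √n + (ε / (c + 1) * √n + C) * ‖empiricalMeasure σ - m‖ ^ 2) := by
    have h1 := (abs_le.1 (h m hm hb _ (empiricalMeasure_mem_stdSimplex hn σ))).2
    set t := ‖empiricalMeasure σ - m‖
    -- Splitting the linear error at the scale `n^(-1/2)` of `t` leaves quadratic terms only.
    have h2 : t ≤ 1 / √n + √n * t ^ 2 := by
      rw [← sub_nonneg]
      have : 1 / √(n : ℝ) + √n * t ^ 2 - t = ((√n * t - 1 / 2) ^ 2 + 3 / 4) / √n := by
        field_simp
        ring
      rw [this]
      positivity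
    have h3 : ε / (c + 1) * t ≤ ε / (c + 1) * (1 / √n + √n * t ^ 2) := by gcongr
    linarith [h3, show ε / (c + 1) * (1 / √n + √n * t ^ 2) =
      ε / (c + 1) / √n + ε / (c + 1) * √n * t ^ 2 by ring]
  have hF' : ∑ σ, Q σ * F (empiricalMeasure σ) ≤
      F m + (ε / (c + 1) / √n + (ε / (c + 1) * √n + C) * (c / n)) := by
    calc _ ≤ ∑ σ, Q σ * (F m + dF F x (empiricalMeasure σ - m) +
          (ε / (c + 1) / √n + (ε / (c + 1) * √n + C) * ‖empiricalMeasure σ - m‖ ^ 2)) :=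
          Finset.sum_le_sum fun σ _ => mul_le_mul_of_nonneg_left (hterm σ) (hQ0 σ)
      _ = (∑ σ, Q σ) * (F m + ε / (c + 1) / √n) + ∑ σ, Q σ * dF F x (empiricalMeasure σ - m) +
          (ε / (c + 1) * √n + C) * ∑ σ, Q σ * ‖empiricalMeasure σ - m‖ ^ 2 := by
          rw [Finset.sum_mul, Finset.mul_sum, ← Finset.sum_add_distrib, ← Finset.sum_add_distrib]
          exact Finset.sum_congr rfl fun σ _ => by ring
      _ ≤ _ := by
          rw [hQ1, hlin]
          have : (ε / (c + 1) * √n + C) * ∑ σ, Q σ * ‖empiricalMeasure σ - m‖ ^ 2 ≤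
            (ε / (c + 1) * √n + C) * (c / n) := by gcongr
          linarith
  have hsum : ∑ σ, Q σ * (n * F (empiricalMeasure σ)) = n * ∑ σ, Q σ * F (empiricalMeasure σ) := by
    rw [Finset.mul_sum]
    exact Finset.sum_congr rfl fun σ _ => by ring
  have herr : n * (ε / (c + 1) / √n + (ε / (c + 1) * √n + C) * (c / n)) = ε * √n + C * c := by
    have : (n : ℝ) / √n = √n := by rw [div_eq_iff hs0.ne', hss]
    calc _ = ε / (c + 1) * (n / √n) + (ε / (c + 1) * √n + C) * c := by field_simp
      _ = _ := by rw [this]; field_simp; ring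
  have hF'' := mul_le_mul_of_nonneg_left hF' hn0.le
  rw [mul_add, herr] at hF''
  change _ ≤ -(∑ σ, Q σ * (n * F (empiricalMeasure σ))) - _
  rw [hS, hsum, freeEnergy]
  linarith

/-! The upper bound is obtained by sorting the configurations by their type, i.e. by the
conditional empirical measures given the disorder. -/

/-- The conditional empirical measures `L̂(c)` of a configuration `σ` on the sites `i` with
`b(i) = c`. -/
noncomputable def conditionalEmpirical (b : Fin n → E') (σ : Fin n → E) (c : E') (a : E) : ℝ :=
  empiricalMeasure (fun i => (b i, σ i)) (c, a) / empiricalMeasure b c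

omit [Fintype E'] in
lemma sum_empiricalMeasure_prod_right (b : Fin n → E') (σ : Fin n → E) (c : E') :
    ∑ a, empiricalMeasure (fun i => (b i, σ i)) (c, a) = empiricalMeasure b c := by
  simp_rw [empiricalMeasure_apply, ← Finset.mul_sum]
  rw [Finset.sum_comm]
  simp [ite_and]

omit [Fintype E] in
lemma sum_empiricalMeasure_prod_left (b : Fin n → E') (σ : Fin n → E) (a : E) :
    ∑ c, empiricalMeasure (fun i => (b i, σ i)) (c, a) = empiricalMeasure σ a := by
  simp_rw [empiricalMeasure_apply, ← Finset.mul_sum]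
  rw [Finset.sum_comm]
  simp [ite_and]

section Types

variable {b : Fin n → E'} (hb : ∀ c, 0 < empiricalMeasure b c)
include hb

omit [Fintype E] in
lemma mix_conditionalEmpirical (σ : Fin n → E) :
    mix (empiricalMeasure b) (conditionalEmpirical b σ) = empiricalMeasure σ := by
  funext a
  rw [mix_apply, ← sum_empiricalMeasure_prod_left b σ a]
  exact Finset.sum_congr rfl fun c _ => mul_div_cancel₀ _ (hb c).ne'

omit [Fintype E'] in
lemma conditionalEmpirical_mem_finiteDomain {σ : Fin n → E} (hσ : ∀ i, α (b i) (σ i) ≠ 0) :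
    conditionalEmpirical b σ ∈ finiteDomain α := by
  refine ⟨fun c => ⟨fun a => div_nonneg ?_ (hb c).le, ?_⟩, fun c a hα => ?_⟩
  · rw [empiricalMeasure_apply]
    positivity
  · simp only [conditionalEmpirical]
    rw [← Finset.sum_div, sum_empiricalMeasure_prod_right, div_self (hb c).ne']
  · rw [conditionalEmpirical, empiricalMeasure_apply, Finset.sum_eq_zero, mul_zero, zero_div]
    intro i _
    refine if_neg fun h => hσ i ?_
    rw [← hα, ← (Prod.mk.inj h).1, ← (Prod.mk.inj h).2]

/-- The weight of a configuration, in terms of its own type. -/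
lemma boltzmannWeight_eq (hn : n ≠ 0) {σ : Fin n → E} (hσ : ∀ i, α (b i) (σ i) ≠ 0) :
    boltzmannWeight F α b σ = (∏ i, conditionalEmpirical b σ (b i) (σ i)) *
      Real.exp (-(n * freeEnergy F α (empiricalMeasure b) (conditionalEmpirical b σ))) := by
  set ν := conditionalEmpirical b σ
  have hn0 : (0 : ℝ) < n := by positivity
  have hαpos (i : Fin n) : 0 < α (b i) (σ i) := lt_of_le_of_ne ((α (b i)).2.1 _) (hσ i).symm
  have hνpos (i : Fin n) : 0 < ν (b i) (σ i) := by
    refine div_pos ?_ (hb _)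
    rw [empiricalMeasure_apply]
    refine mul_pos (inv_pos.2 hn0) (Finset.sum_pos' (fun j _ => by positivity)
      ⟨i, Finset.mem_univ i, by simp⟩)
  have hlog : ∑ i, Real.log (ν (b i) (σ i) / α (b i) (σ i)) =
      n * ∑ c, empiricalMeasure b c * relEntropy (ν c) (α c) := by
    rw [sum_eq_mul_sum_empiricalMeasure hn (fun i => (b i, σ i))
      fun z : E' × E => Real.log (ν z.1 z.2 / α z.1 z.2), Fintype.sum_prod_type]
    congr 1
    refine Finset.sum_congr rfl fun c _ => ?_
    rw [relEntropy, Finset.mul_sum]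
    refine Finset.sum_congr rfl fun a _ => ?_
    rw [← mul_assoc]
    congr 1
    exact (mul_div_cancel₀ _ (hb c).ne').symm
  rw [freeEnergy, mix_conditionalEmpirical hb, mul_add, ← hlog, neg_add, Real.exp_add,
    ← Finset.sum_neg_distrib, Real.exp_sum, mul_comm (Real.exp _), ← mul_assoc,
    ← Finset.prod_mul_distrib, boltzmannWeight]
  congr 1
  refine Finset.prod_congr rfl fun i _ => ?_
  rw [Real.exp_neg, Real.exp_log (div_pos (hνpos i) (hαpos i)), inv_div,
    mul_div_cancel₀ _ (hνpos i).ne']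

omit hb in
/-- There are polynomially many types. -/
lemma card_image_conditionalEmpirical_le (b : Fin n → E') (S : Finset (Fin n → E)) :
    (S.image (conditionalEmpirical b)).card ≤ (n + 1) ^ (Fintype.card E' * Fintype.card E) := by
  let G : (E' × E → Fin (n + 1)) → E' → E → ℝ := fun N c a =>
    (n : ℝ)⁻¹ * (N (c, a) : ℕ) / empiricalMeasure b c
  have hsub : S.image (conditionalEmpirical b) ⊆ Finset.univ.image G := by
    intro ν hν
    obtain ⟨σ, -, rfl⟩ := Finset.mem_image.1 hν
    refine Finset.mem_image.2 ⟨fun z => ⟨(Finset.univ.filter fun i => (b i, σ i) = z).card,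
      Nat.lt_succ_of_le ((Finset.card_le_univ _).trans_eq (Fintype.card_fin n))⟩,
      Finset.mem_univ _, ?_⟩
    funext c a
    simp only [G, conditionalEmpirical]
    rw [empiricalMeasure_apply fun i => (b i, σ i), Finset.sum_boole]
  calc _ ≤ (Finset.univ.image G).card := Finset.card_le_card hsub
    _ ≤ Fintype.card (E' × E → Fin (n + 1)) := Finset.card_image_le
    _ = _ := by simp

/-- Upper bound on the total weight of the configurations with empirical measure in a set `A`, by
the minimum of the free energy over the corresponding types. -/
lemma sum_boltzmannWeight_le (hn : n ≠ 0) {A : Set (E → ℝ)} [DecidablePred (· ∈ A)] {c : ℝ}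
    (h : ∀ ν ∈ finiteDomain α, mix (empiricalMeasure b) ν ∈ A →
      c ≤ freeEnergy F α (empiricalMeasure b) ν) :
    ∑ σ : Fin n → E with empiricalMeasure σ ∈ A, boltzmannWeight F α b σ ≤
      ((n : ℝ) + 1) ^ (Fintype.card E' * Fintype.card E) * Real.exp (-(n * c)) := by
  set S : Finset (Fin n → E) :=
    Finset.univ.filter fun σ => empiricalMeasure σ ∈ A ∧ ∀ i, α (b i) (σ i) ≠ 0
  have hS : ∑ σ : Fin n → E with empiricalMeasure σ ∈ A, boltzmannWeight F α b σ =
      ∑ σ ∈ S, boltzmannWeight F α b σ := by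
    refine (Finset.sum_subset (fun σ hσ => ?_) fun σ hσ hσS => ?_).symm
    · simp only [S, Finset.mem_filter] at hσ ⊢
      exact ⟨hσ.1, hσ.2.1⟩
    · simp only [S, Finset.mem_filter, Finset.mem_univ, true_and, not_and, not_forall,
        not_not] at hσ hσS
      obtain ⟨i, hi⟩ := hσS hσ
      rw [boltzmannWeight, Finset.prod_eq_zero (Finset.mem_univ i) hi, zero_mul]
  have hmem : ∀ σ ∈ S, conditionalEmpirical b σ ∈ finiteDomain α := fun σ hσ =>
    conditionalEmpirical_mem_finiteDomain hb (Finset.mem_filter.1 hσ).2.2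
  have hprod : ∑ σ ∈ S, ∏ i, conditionalEmpirical b σ (b i) (σ i) ≤
      ((n : ℝ) + 1) ^ (Fintype.card E' * Fintype.card E) := by
    rw [← Finset.sum_fiberwise_of_maps_to (t := S.image (conditionalEmpirical b))
      fun σ hσ => Finset.mem_image_of_mem _ hσ]
    -- The configurations of type `ν` have total probability at most one under the product of the
    -- vectors `ν(b(i))`.
    calc _ ≤ ∑ _ν ∈ S.image (conditionalEmpirical b), (1 : ℝ) := by
          refine Finset.sum_le_sum fun ν hν => ?_
          obtain ⟨τ, hτ, rfl⟩ := Finset.mem_image.1 hν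
          have hD := hmem τ hτ
          set ν := conditionalEmpirical b τ
          calc _ = ∑ σ ∈ S with conditionalEmpirical b σ = ν, ∏ i, ν (b i) (σ i) :=
                Finset.sum_congr rfl fun σ hσ => by rw [(Finset.mem_filter.1 hσ).2]
            _ ≤ ∑ σ : Fin n → E, ∏ i, ν (b i) (σ i) :=
                Finset.sum_le_univ_sum_of_nonneg fun σ =>
                  Finset.prod_nonneg fun i _ => (hD.1 (b i)).1 _
            _ = 1 := sum_prod_eq_one fun i => (hD.1 (b i)).2
      _ ≤ _ := by
          rw [Finset.sum_const, nsmul_eq_mul, mul_one]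
          exact_mod_cast card_image_conditionalEmpirical_le b S
  rw [hS]
  calc _ ≤ ∑ σ ∈ S, (∏ i, conditionalEmpirical b σ (b i) (σ i)) * Real.exp (-(n * c)) := by
        refine Finset.sum_le_sum fun σ hσ => ?_
        have hD := hmem σ hσ
        simp only [S, Finset.mem_filter, Finset.mem_univ, true_and] at hσ
        rw [boltzmannWeight_eq hb hn hσ.2]
        have := h _ hD (by rw [mix_conditionalEmpirical hb]; exact hσ.1)
        refine mul_le_mul_of_nonneg_left ?_ (Finset.prod_nonneg fun i _ => (hD.1 (b i)).1 _)
        refine Real.exp_le_exp.2 (neg_le_neg ?_)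
        gcongr
    _ ≤ _ := by
        rw [← Finset.sum_mul]
        gcongr

end Types

end PartitionBounds

/-! ### Convergence of the Gibbs measures for a fixed disorder sequence -/

section UpperBounds

variable {E : Type*} [Fintype E] [TopologicalSpace E] [DiscreteTopology E]
  [MeasurableSpace E] [MeasurableSingletonClass E]

/-- For weak convergence it suffices to bound the cylinder probabilities asymptotically from above,
since the probabilities of all cylinders of the same length add up to one. -/
lemma tendsto_of_eventually_cylinder_le {ι : Type*} {l : Filter ι} [l.IsCountablyGenerated]
    {μ : ι → ProbabilityMeasure (ℕ → E)} {ν : ProbabilityMeasure (ℕ → E)}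
    (h : ∀ x k, ∀ ε > 0, ∀ᶠ i in l, (μ i : Measure (ℕ → E)).real (PiNat.cylinder x k) ≤
      (ν : Measure (ℕ → E)).real (PiNat.cylinder x k) + ε) : Tendsto μ l (𝓝 ν) := by
  refine tendsto_of_tendsto_cylinder fun x k => ?_
  let y : (Fin k → E) → ℕ → E := fun a i => if h : i < k then a ⟨i, h⟩ else x i
  have hy : y (fun i => x i) = x := by
    funext i
    simp [y]
  have hsum (ρ : ProbabilityMeasure (ℕ → E)) :
      ∑ a, (ρ : Measure (ℕ → E)).real (PiNat.cylinder (y a) k) = 1 := by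
    have hpre (a : Fin k → E) :
        PiNat.cylinder (y a) k = (fun ω (i : Fin k) => ω i) ⁻¹' {a} := by
      ext ω
      simp only [PiNat.mem_cylinder_iff, Set.mem_preimage, Set.mem_singleton_iff, funext_iff]
      exact ⟨fun h i => by simpa [y] using h i i.2, fun h i hi => by simpa [y, hi] using h ⟨i, hi⟩⟩
    simp_rw [hpre]
    rw [sum_measureReal_preimage_singleton _ fun a _ =>
      measurable_initial k (measurableSet_singleton a)]
    simp
  set N : ℝ := (Fintype.card (Fin k → E) : ℝ)
  have hN : 0 < N := Nat.cast_pos.2 (Fintype.card_pos_iff.2 ⟨fun i => x i⟩)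
  refine Metric.tendsto_nhds.2 fun ε hε => ?_
  have hall : ∀ᶠ i in l, ∀ a, (μ i : Measure (ℕ → E)).real (PiNat.cylinder (y a) k) ≤
      (ν : Measure (ℕ → E)).real (PiNat.cylinder (y a) k) + ε / 2 / N :=
    eventually_all.2 fun a => h (y a) k _ (by positivity)
  filter_upwards [hall] with i hi
  have htot : ∑ a, ((ν : Measure (ℕ → E)).real (PiNat.cylinder (y a) k) + ε / 2 / N -
      (μ i : Measure (ℕ → E)).real (PiNat.cylinder (y a) k)) = ε / 2 := by
    rw [Finset.sum_sub_distrib, Finset.sum_add_distrib, hsum, hsum]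
    simp only [Finset.sum_const, Finset.card_univ, nsmul_eq_mul]
    rw [mul_div_cancel₀ _ hN.ne']
    ring
  have h1 := Finset.single_le_sum (f := fun a => (ν : Measure (ℕ → E)).real
    (PiNat.cylinder (y a) k) + ε / 2 / N - (μ i : Measure (ℕ → E)).real (PiNat.cylinder (y a) k))
    (fun a _ => sub_nonneg.2 (hi a)) (Finset.mem_univ fun i : Fin k => x i)
  have h2 := hi fun i : Fin k => x i
  have h3 : ε / 2 / N ≤ ε / 2 := by
    refine div_le_self (by positivity) ?_
    exact Nat.one_le_cast.2 (Nat.cast_pos.1 hN)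
  have h4 : 0 < ε / 2 / N := by positivity
  simp only [hy] at h1 h2
  rw [Real.dist_eq, abs_lt]
  constructor <;> linarith

end UpperBounds

section Local

variable {E E' : Type*} [Fintype E] [DecidableEq E] {F : (E → ℝ) → ℝ} {α : E' → stdSimplex ℝ E}

omit [Fintype E] in
lemma natCast_smul_empiricalMeasure_append {k m : ℕ} (hn : k + m ≠ 0)
    (a : Fin k → E) (τ : Fin m → E) :
    ((k + m : ℕ) : ℝ) • empiricalMeasure (Fin.append a τ) =
      ∑ i, Pi.single (a i) 1 + ∑ j, Pi.single (τ j) 1 := by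
  rw [empiricalMeasure, smul_inv_smul₀ (Nat.cast_ne_zero.2 hn), Fin.sum_univ_add]
  simp

/-- Changing `k` of `n` spins, while the empirical measure stays close to `x`, changes the Gibbs
weight as if the spins were independent with weights `gammaWeight F α b x`. -/
lemma boltzmannWeight_append_mul_le {x : E → ℝ} {r ε : ℝ} (hε : 0 ≤ ε)
    (hS : ∀ y ∈ stdSimplex ℝ E, ∀ z ∈ stdSimplex ℝ E, ‖y - x‖ < r → ‖z - x‖ < r →
      |F z - F y - dF F x (z - y)| ≤ ε * ‖z - y‖)
    {k m : ℕ} (hn : k + m ≠ 0) (hk : (k : ℝ) / (k + m : ℕ) < r / 2) (b : Fin (k + m) → E')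
    (a a' : Fin k → E) (τ : Fin m → E)
    (hnear : ‖empiricalMeasure (Fin.append a' τ) - x‖ < r / 2) :
    boltzmannWeight F α b (Fin.append a' τ) *
        ∏ i, gammaWeight F α (b (Fin.castAdd m i)) x (a i) ≤
      Real.exp (ε * k) * (boltzmannWeight F α b (Fin.append a τ) *
        ∏ i, gammaWeight F α (b (Fin.castAdd m i)) x (a' i)) := by
  set n : ℝ := ((k + m : ℕ) : ℝ) with hndef
  have hn0 : 0 < n := by
    rw [hndef]
    exact_mod_cast Nat.pos_of_ne_zero hn
  set L := empiricalMeasure (Fin.append a τ)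
  set L' := empiricalMeasure (Fin.append a' τ)
  have hdiff : n • (L - L') = ∑ i, (Pi.single (a i) (1 : ℝ) - Pi.single (a' i) 1) := by
    rw [smul_sub, natCast_smul_empiricalMeasure_append hn, natCast_smul_empiricalMeasure_append hn,
      Finset.sum_sub_distrib]
    abel
  have hnorm : n * ‖L - L'‖ ≤ k := by
    rw [← abs_of_pos hn0, ← Real.norm_eq_abs, ← norm_smul, hdiff]
    refine (norm_sum_le _ _).trans ?_
    calc _ ≤ ∑ _i : Fin k, (1 : ℝ) := by
          refine Finset.sum_le_sum fun i _ => (pi_norm_le_iff_of_nonneg zero_le_one).2 fun c => ?_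
          simp only [Pi.sub_apply, Pi.single_apply]
          split_ifs <;> simp
      _ = k := by simp
  have hL : ‖L - x‖ < r := by
    have h1 : ‖L - L'‖ ≤ k / n := by
      rw [le_div_iff₀ hn0, mul_comm]
      exact hnorm
    have h2 : ‖L - x‖ ≤ ‖L - L'‖ + ‖L' - x‖ := norm_sub_le_norm_sub_add_norm_sub L L' x
    linarith
  have hL' : ‖L' - x‖ < r := by linarith [norm_nonneg (L' - x)]
  have hexp := (abs_le.1 (hS L' (empiricalMeasure_mem_stdSimplex hn _) L
    (empiricalMeasure_mem_stdSimplex hn _) hL' hL)).2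
  have hlin : n * dF F x (L - L') = ∑ i, dF F x (Pi.single (a i) 1 - x) -
      ∑ i, dF F x (Pi.single (a' i) 1 - x) := by
    rw [← smul_eq_mul, ← map_smul, hdiff, map_sum, ← Finset.sum_sub_distrib]
    refine Finset.sum_congr rfl fun i _ => ?_
    rw [← map_sub, sub_sub_sub_cancel_right]
  have hkey : -(n * F L') + -∑ i, dF F x (Pi.single (a i) 1 - x) ≤
      ε * k + (-(n * F L) + -∑ i, dF F x (Pi.single (a' i) 1 - x)) := by
    have h1 := mul_le_mul_of_nonneg_left hexp hn0.le
    have h2 := mul_le_mul_of_nonneg_left hnorm hε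
    linarith
  have hkey' := Real.exp_le_exp.2 hkey
  rw [Real.exp_add, Real.exp_add, Real.exp_add, ← Finset.sum_neg_distrib, ← Finset.sum_neg_distrib,
    Real.exp_sum, Real.exp_sum] at hkey'
  set A : (Fin k → E) → ℝ := fun a => ∏ i, α (b (Fin.castAdd m i)) (a i)
  set T : ℝ := ∏ j, α (b (Fin.natAdd k j)) (τ j)
  have hA (a : Fin k → E) : 0 ≤ A a := Finset.prod_nonneg fun i _ => (α _).2.1 _
  have hT : 0 ≤ T := Finset.prod_nonneg fun i _ => (α _).2.1 _
  have hw (a : Fin k → E) : boltzmannWeight F α b (Fin.append a τ) =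
      A a * T * Real.exp (-(n * F (empiricalMeasure (Fin.append a τ)))) := by
    rw [boltzmannWeight, Fin.prod_univ_add]
    simp [A, T, hndef]
  have hG (a : Fin k → E) : ∏ i, gammaWeight F α (b (Fin.castAdd m i)) x (a i) =
      (∏ i, Real.exp (-dF F x (Pi.single (a i) 1 - x))) * A a := by
    simp only [gammaWeight, Finset.prod_mul_distrib, A]
  rw [hw, hw, hG, hG]
  calc _ = A a * A a' * T * (Real.exp (-(n * F L')) *
          ∏ i, Real.exp (-dF F x (Pi.single (a i) 1 - x))) := by ring
    _ ≤ A a * A a' * T * (Real.exp (ε * k) * (Real.exp (-(n * F L)) *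
          ∏ i, Real.exp (-dF F x (Pi.single (a' i) 1 - x)))) :=
        mul_le_mul_of_nonneg_left hkey' (mul_nonneg (mul_nonneg (hA a) (hA a')) hT)
    _ = _ := by ring

lemma partitionFunction_eq_sum_append {k m : ℕ} (b : Fin (k + m) → E') :
    partitionFunction F α b =
      ∑ a : Fin k → E, ∑ τ : Fin m → E, boltzmannWeight F α b (Fin.append a τ) := by
  rw [partitionFunction, ← (Fin.appendEquiv k m).sum_comp, Fintype.sum_prod_type]
  rfl

/-- Summing the local comparison over all values of the first `k` spins: up to configurations with
empirical measure away from `x`, the first `k` spins are distributed at most as under the kernels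
`γ[b(i)](· | x)`. -/
lemma sum_append_boltzmannWeight_le {x : E → ℝ} {r ε : ℝ} (hε : 0 ≤ ε)
    (hS : ∀ y ∈ stdSimplex ℝ E, ∀ z ∈ stdSimplex ℝ E, ‖y - x‖ < r → ‖z - x‖ < r →
      |F z - F y - dF F x (z - y)| ≤ ε * ‖z - y‖)
    {k m : ℕ} (hn : k + m ≠ 0) (hk : (k : ℝ) / (k + m : ℕ) < r / 2) (b : Fin (k + m) → E')
    (a' : Fin k → E) :
    ∑ τ : Fin m → E, boltzmannWeight F α b (Fin.append a' τ) ≤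
      Real.exp (ε * k) * partitionFunction F α b *
        ∏ i, (gammaKernel F α (b (Fin.castAdd m i)) x) (a' i) +
      ∑ σ : Fin (k + m) → E with r / 2 ≤ ‖empiricalMeasure σ - x‖, boltzmannWeight F α b σ := by
  set G : (Fin k → E) → ℝ := fun a => ∏ i, gammaWeight F α (b (Fin.castAdd m i)) x (a i)
  have hG0 (a : Fin k → E) : 0 ≤ G a := Finset.prod_nonneg fun i _ => gammaWeight_nonneg _ _ _ _ _
  have hΓ : ∑ a, G a = ∏ i, ∑ c, gammaWeight F α (b (Fin.castAdd m i)) x c :=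
    sum_prod_eq_prod_sum fun i c => gammaWeight F α (b (Fin.castAdd m i)) x c
  have hΓ0 : 0 < ∑ a, G a := by
    rw [hΓ]
    exact Finset.prod_pos fun i _ => sum_gammaWeight_pos _ _ _ _
  have hγ : ∏ i, (gammaKernel F α (b (Fin.castAdd m i)) x) (a' i) = G a' / ∑ a, G a := by
    rw [hΓ, ← Finset.prod_div_distrib]
    rfl
  set W : (Fin k → E) → (Fin m → E) → ℝ := fun a τ => boltzmannWeight F α b (Fin.append a τ)
  have hW0 (a : Fin k → E) (τ : Fin m → E) : 0 ≤ W a τ := boltzmannWeight_nonneg _ _ _ _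
  set far : (Fin k → E) → (Fin m → E) → Prop :=
    fun a τ => r / 2 ≤ ‖empiricalMeasure (Fin.append a τ) - x‖
  set R := ∑ σ : Fin (k + m) → E with r / 2 ≤ ‖empiricalMeasure σ - x‖, boltzmannWeight F α b σ
    with hR
  have hfar : ∑ τ with far a' τ, W a' τ ≤ R := by
    have : R = ∑ a, ∑ τ with far a τ, W a τ := by
      simp_rw [hR, Finset.sum_filter]
      rw [← (Fin.appendEquiv k m).sum_comp, Fintype.sum_prod_type]
      rfl
    rw [this]
    exact Finset.single_le_sum (f := fun a => ∑ τ with far a τ, W a τ)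
      (fun a _ => Finset.sum_nonneg fun τ _ => hW0 a τ) (Finset.mem_univ a')
  have hnear : (∑ τ with ¬ far a' τ, W a' τ) * ∑ a, G a ≤
      Real.exp (ε * k) * partitionFunction F α b * G a' := by
    rw [Finset.mul_sum]
    calc ∑ a, (∑ τ with ¬ far a' τ, W a' τ) * G a ≤
          ∑ a, Real.exp (ε * k) * ((∑ τ, W a τ) * G a') := by
          refine Finset.sum_le_sum fun a _ => ?_
          rw [Finset.sum_mul, Finset.sum_mul, Finset.mul_sum]
          refine (Finset.sum_le_sum fun τ hτ => ?_).trans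
            (Finset.sum_le_univ_sum_of_nonneg fun τ =>
              mul_nonneg (Real.exp_pos _).le (mul_nonneg (hW0 a τ) (hG0 a')))
          exact boltzmannWeight_append_mul_le hε hS hn hk b a a' τ
            (not_le.1 (Finset.mem_filter.1 hτ).2)
      _ = _ := by
          rw [partitionFunction_eq_sum_append, ← Finset.mul_sum, ← Finset.sum_mul, mul_assoc]
  rw [hγ, ← Finset.sum_filter_add_sum_filter_not Finset.univ (far a'), mul_div_assoc', add_comm]
  exact add_le_add ((le_div_iff₀ hΓ0).2 hnear) hfar

variable [MeasurableSpace E] [MeasurableSingletonClass E]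

lemma purePhase_real_cylinder [Fintype E'] (π : stdSimplex ℝ E') (ν : E' → E → ℝ) (η : ℕ → E')
    (x : ℕ → E) (k : ℕ) :
    (purePhase F α π ν η : Measure (ℕ → E)).real (PiNat.cylinder x k) =
      ∏ i : Fin k, (gammaKernel F α (η i) (mix π ν)) (x i) := by
  rw [← measureReal_infinitePi_law_eq (fun i => gammaKernel F α (η i) (mix π ν)) fun i => x i]
  rw [cylinder_eq_setOf_forall_fin]
  rfl

end Local

section Selection

variable {E E' : Type*} [Fintype E] [Fintype E'] [DecidableEq E] [DecidableEq E']
  {F : (E → ℝ) → ℝ} {α : E' → stdSimplex ℝ E} {π : stdSimplex ℝ E'}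

/-- The disorder sequences whose first `n` terms favour the phase `ν₁` over `ν₂` with a margin
`δ √n` in the exponent, and whose empirical measure is at the distance `O(n^(-1/2))` from `π`. -/
def favourable (F : (E → ℝ) → ℝ) (α : E' → stdSimplex ℝ E) (π : stdSimplex ℝ E')
    (ν₁ ν₂ : E' → E → ℝ) (δ : ℝ) (n : ℕ) : Set (ℕ → E') :=
  {η | ‖empiricalMeasure (fun i : Fin n => η i) - ⇑π‖ ≤ δ⁻¹ / √n ∧
    δ * √n ≤ n * ∑ b, (empiricalMeasure (fun i : Fin n => η i) - ⇑π) b *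
      (disorderGradient F α π ν₂ b - disorderGradient F α π ν₁ b)}

lemma tendsto_add_one_pow_mul_exp_neg_sqrt (D : ℕ) {δ : ℝ} (hδ : 0 < δ) (C : ℝ) :
    Tendsto (fun n : ℕ => ((n : ℝ) + 1) ^ D * Real.exp (-δ * √n + C)) atTop (𝓝 0) := by
  have h1 := (tendsto_rpow_mul_exp_neg_mul_atTop_nhds_zero ((2 * D : ℕ) : ℝ) δ hδ).comp
    (Real.tendsto_sqrt_atTop.comp tendsto_natCast_atTop_atTop)
  have h2 := h1.const_mul (2 ^ D * Real.exp C)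
  rw [mul_zero] at h2
  refine squeeze_zero' (Eventually.of_forall fun n => by positivity) ?_ h2
  filter_upwards [eventually_ge_atTop 1] with n hn
  have hn1 : (1 : ℝ) ≤ n := by exact_mod_cast hn
  have hle : ((n : ℝ) + 1) ^ D ≤ 2 ^ D * √(n : ℝ) ^ (2 * D) := by
    rw [pow_mul, Real.sq_sqrt (by positivity), ← mul_pow]
    gcongr
    linarith
  simp only [Function.comp_apply, Real.rpow_natCast]
  rw [Real.exp_add]
  calc _ ≤ 2 ^ D * √(n : ℝ) ^ (2 * D) * (Real.exp (-δ * √n) * Real.exp C) := by gcongr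
    _ = _ := by ring

/-- Along the volumes in which the disorder favours `ν₁`, the Gibbs weight of the configurations
whose empirical measure is away from that of `ν₁` is negligible: the exponential gain `exp(δ √n)`
dominates the entropic and Gaussian corrections. -/
lemma tendsto_sum_far_div_partitionFunction (hF : ContDiffOn ℝ 2 F (stdSimplex ℝ E))
    (hπ : ∀ b, 0 < π b) {ν₁ ν₂ : E' → E → ℝ} (hM : minimizers F α π = {ν₁, ν₂}) {δ r : ℝ}
    (hδ : 0 < δ) (hr : 0 < r) (η : ℕ → E') :
    Tendsto (fun n : ℕ => (∑ σ : Fin n → E with r ≤ ‖empiricalMeasure σ - mix π ν₁‖,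
        boltzmannWeight F α (fun i => η i) σ) / partitionFunction F α (fun i : Fin n => η i))
      (atTop ⊓ 𝓟 {n | η ∈ favourable F α π ν₁ ν₂ δ n}) (𝓝 0) := by
  set l : Filter ℕ := atTop ⊓ 𝓟 {n | η ∈ favourable F α π ν₁ ν₂ δ n}
  set p : ℕ → E' → ℝ := fun n => empiricalMeasure fun i : Fin n => η i
  have hl : l ≤ atTop := inf_le_left
  have hfav : ∀ᶠ n in l, η ∈ favourable F α π ν₁ ν₂ δ n :=
    eventually_inf_principal.2 (Eventually.of_forall fun n h => h)
  have hν₁ : ν₁ ∈ minimizers F α π := by simp [hM]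
  have hν₂ : ν₂ ∈ minimizers F α π := by simp [hM]
  have hΦ : freeEnergy F α π ν₁ = freeEnergy F α π ν₂ :=
    le_antisymm (hν₁.2 _ hν₂.1) (hν₂.2 _ hν₁.1)
  have hsqrt : Tendsto (fun n : ℕ => √(n : ℝ)) atTop atTop :=
    Real.tendsto_sqrt_atTop.comp tendsto_natCast_atTop_atTop
  have hp : Tendsto p l (𝓝 π) := by
    refine tendsto_iff_norm_sub_tendsto_zero.2 (squeeze_zero' (Eventually.of_forall fun n =>
      norm_nonneg _) (hfav.mono fun n h => h.1) ?_)
    exact (tendsto_const_nhds.div_atTop hsqrt).mono_left hl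
  -- `ε` is such that `ε √n` and `2 ε n ‖p - π‖` together use up half of the margin `δ √n`.
  set ε : ℝ := δ / (2 * (2 * δ⁻¹ + 1)) with hεdef
  have hε : 0 < ε := by positivity
  have hεδ : ε * (2 * δ⁻¹ + 1) = δ / 2 := by
    rw [hεdef]
    field_simp
  obtain ⟨ρ, hρ, C, hlow⟩ := exists_exp_le_partitionFunction hF π hν₁.1 hε
  have e1 : ∀ᶠ n in l, ‖mix (p n) ν₁ - mix π ν₁‖ < ρ := by
    have h : Continuous fun q : E' → ℝ => ‖mix q ν₁ - mix π ν₁‖ :=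
      ((continuous_mix.comp (continuous_id.prodMk continuous_const)).sub continuous_const).norm
    have h' := (h.tendsto π).comp hp
    simp only [sub_self, norm_zero] at h'
    exact h'.eventually (gt_mem_nhds hρ)
  have e2 := hp.eventually (eventually_le_freeEnergy_of_far hF hM hε hr)
  have e3 := (hp.prodMk_nhds (tendsto_const_nhds (x := ν₁))).eventually
    (eventually_abs_freeEnergy_sub_le hF (π := π) hν₁.1 hε)
  have e4 : ∀ᶠ n in l, ∀ b, 0 < p n b :=
    eventually_all.2 fun b => (tendsto_pi_nhds.1 hp b).eventually (lt_mem_nhds (hπ b))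
  refine squeeze_zero' (Eventually.of_forall fun n => div_nonneg
    (Finset.sum_nonneg fun σ _ => boltzmannWeight_nonneg _ _ _ _)
    (Finset.sum_nonneg fun σ _ => boltzmannWeight_nonneg _ _ _ _)) ?_
    ((tendsto_add_one_pow_mul_exp_neg_sqrt (Fintype.card E' * Fintype.card E) (half_pos hδ)
      C).mono_left hl)
  filter_upwards [e1, e2, e3, e4, hfav, hl (eventually_ne_atTop 0)] with n h1 h2 h3 h4 h5 hn
  have hn0 : (0 : ℝ) < n := by positivity
  have hs0 : 0 < √(n : ℝ) := Real.sqrt_pos.2 hn0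
  have hss : √(n : ℝ) * √n = n := Real.mul_self_sqrt hn0.le
  have hpS : p n ∈ stdSimplex ℝ E' := empiricalMeasure_mem_stdSimplex hn _
  have hup := sum_boltzmannWeight_le (F := F) (α := α) (b := fun i : Fin n => η i) h4 hn
    (A := {y | r ≤ ‖y - mix π ν₁‖}) (h2 hpS)
  have hZ := hlow n hn (fun i : Fin n => η i) h1
  have hΦ1 := (abs_le.1 (h3 hpS hν₁.1)).2
  rw [div_le_iff₀ ((Real.exp_pos _).trans_le hZ)]
  refine hup.trans ?_
  rw [mul_assoc]
  refine mul_le_mul_of_nonneg_left ?_ (by positivity)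
  refine le_trans ?_ (mul_le_mul_of_nonneg_left hZ (Real.exp_pos _).le)
  rw [← Real.exp_add]
  refine Real.exp_le_exp.2 ?_
  have hdist : n * ‖p n - ⇑π‖ ≤ δ⁻¹ * √n := by
    calc n * ‖p n - ⇑π‖ ≤ n * (δ⁻¹ / √n) := by gcongr; exact h5.1
      _ = δ⁻¹ * √n := by
        rw [mul_div_assoc', div_eq_iff hs0.ne', mul_assoc, hss, mul_comm]
  have hmargin : δ * √n ≤ n * (∑ b, (p n - ⇑π) b * disorderGradient F α π ν₂ b -
      ∑ b, (p n - ⇑π) b * disorderGradient F α π ν₁ b) := by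
    rw [← Finset.sum_sub_distrib]
    simp_rw [← mul_sub]
    exact h5.2
  have hΦ2 := mul_le_mul_of_nonneg_left hΦ1 hn0.le
  have hd2 := mul_le_mul_of_nonneg_left hdist hε.le
  have hεδ' : (ε * (2 * δ⁻¹ + 1)) * √(n : ℝ) = δ / 2 * √n := by rw [hεδ]
  rw [hΦ] at hΦ2
  change _ ≤ -(δ / 2) * √n + C + -(n * freeEnergy F α (p n) ν₁ + ε * √n + C)
  linarith

variable [Nonempty E] [TopologicalSpace E] [DiscreteTopology E]
  [MeasurableSpace E] [MeasurableSingletonClass E]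

/-- Along the volumes in which the disorder favours `ν₁`, the Gibbs measures converge to the pure
phase of `ν₁`. -/
theorem tendsto_gibbs_purePhase (hF : ContDiffOn ℝ 2 F (stdSimplex ℝ E))
    (hπ : ∀ b, 0 < π b) {ν₁ ν₂ : E' → E → ℝ} (hM : minimizers F α π = {ν₁, ν₂}) {δ : ℝ}
    (hδ : 0 < δ) (η : ℕ → E') :
    Tendsto (fun n => gibbs F α n η) (atTop ⊓ 𝓟 {n | η ∈ favourable F α π ν₁ ν₂ δ n})
      (𝓝 (purePhase F α π ν₁ η)) := by
  have hν₁ : ν₁ ∈ minimizers F α π := by simp [hM]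
  refine tendsto_of_eventually_cylinder_le fun x k κ hκ => ?_
  rw [purePhase_real_cylinder]
  set g : ℝ := ∏ i : Fin k, (gammaKernel F α (η i) (mix π ν₁)) (x i)
  have hg0 : 0 ≤ g := Finset.prod_nonneg fun i _ => (gammaKernel _ _ _ _).2.1 _
  obtain ⟨ε, hε, hεk⟩ : ∃ ε > 0, Real.exp (ε * k) * g < g + κ / 2 := by
    have h : Tendsto (fun ε : ℝ => Real.exp (ε * k) * g) (𝓝[>] 0) (𝓝 g) := by
      have : Continuous fun ε : ℝ => Real.exp (ε * k) * g := by fun_prop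
      simpa using (this.tendsto 0).mono_left nhdsWithin_le_nhds
    have h' := (h.eventually (gt_mem_nhds (show g < g + κ / 2 by linarith))).and
      self_mem_nhdsWithin
    obtain ⟨ε, h1, h2⟩ := h'.exists
    exact ⟨ε, h2, h1⟩
  have hx : mix π ν₁ ∈ stdSimplex ℝ E := mix_mem_stdSimplex π.2 hν₁.1.1
  obtain ⟨r, hr, hS⟩ := exists_abs_sub_sub_dF_le hF hx hε
  have hk : ∀ᶠ n : ℕ in atTop, (k : ℝ) / n < r / 2 :=
    (tendsto_const_nhds.div_atTop tendsto_natCast_atTop_atTop).eventually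
      (gt_mem_nhds (half_pos hr))
  have hfar := (tendsto_sum_far_div_partitionFunction hF hπ hM hδ (half_pos hr) η).eventually
    (gt_mem_nhds (half_pos hκ))
  have hl : atTop ⊓ 𝓟 {n | η ∈ favourable F α π ν₁ ν₂ δ n} ≤ atTop := inf_le_left
  filter_upwards [hfar, hl hk, hl (eventually_ge_atTop (k + 1))] with n h1 h2 h3
  obtain ⟨m, rfl⟩ := Nat.exists_eq_add_of_le (show k ≤ n by omega)
  have hn : k + m ≠ 0 := by omega
  rw [gibbs_real_cylinder]
  -- The first `k` spins are compared with independent ones, the other `m` spins being fixed.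
  set Z := partitionFunction F α fun i : Fin (k + m) => η i
  set R := ∑ σ : Fin (k + m) → E with r / 2 ≤ ‖empiricalMeasure σ - mix π ν₁‖,
    boltzmannWeight F α (fun i => η i) σ
  have hZ : 0 < Z := by
    refine lt_of_le_of_ne (Finset.sum_nonneg fun σ _ => boltzmannWeight_nonneg _ _ _ _) fun h => ?_
    have := exp_le_partitionFunction (F := F) hν₁.1 fun i : Fin (k + m) => η i
    rw [show partitionFunction F α (fun i : Fin (k + m) => η i) = 0 from h.symm] at this
    exact absurd this (not_le.2 (Real.exp_pos _))
  have hle := sum_append_boltzmannWeight_le (F := F) (α := α) hε.le hS hn h2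
    (fun i : Fin (k + m) => η i) fun i => x i
  calc _ ≤ (Real.exp (ε * k) * Z * g + R) / Z := div_le_div_of_nonneg_right hle hZ.le
    _ = Real.exp (ε * k) * g + R / Z := by
        rw [add_div, mul_right_comm, mul_div_cancel_right₀ _ hZ.ne']
    _ ≤ g + κ := by linarith

end Selection

section Continuity

variable {E E' : Type*} [Fintype E] [Fintype E'] [DecidableEq E] [Nonempty E] [TopologicalSpace E]
  [DiscreteTopology E] [MeasurableSpace E] [MeasurableSingletonClass E]
  [TopologicalSpace E'] [DiscreteTopology E']

omit [Fintype E'] in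
lemma continuous_gibbs (F : (E → ℝ) → ℝ) (α : E' → stdSimplex ℝ E) (n : ℕ) :
    Continuous (gibbs F α n) := by
  refine continuous_of_cylinder_dependsOn fun x k => ⟨n, fun η η' h => ?_⟩
  have hA : aPriori α n η = aPriori α n η' := by
    unfold aPriori
    congr 1
    funext i
    split_ifs with hi
    · rw [h i hi]
    · rfl
  change ((aPriori α n η).tilted _).real _ = ((aPriori α n η').tilted _).real _
  rw [hA]

omit [Nonempty E] in
lemma continuous_purePhase (F : (E → ℝ) → ℝ) (α : E' → stdSimplex ℝ E) (π : stdSimplex ℝ E')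
    (ν : E' → E → ℝ) : Continuous (purePhase F α π ν) := by
  refine continuous_of_cylinder_dependsOn fun x k => ⟨k, fun η η' h => ?_⟩
  rw [purePhase_real_cylinder, purePhase_real_cylinder]
  exact Finset.prod_congr rfl fun i _ => by rw [h i i.2]

end Continuity

/-! ### Fluctuations of the disorder -/

section Fluctuations

variable {E' : Type*} [Fintype E'] [MeasurableSpace E'] [MeasurableSingletonClass E']
  {π : stdSimplex ℝ E'} {h : E' → ℝ}

instance isProbabilityMeasure_disorderLaw (π : stdSimplex ℝ E') :
    IsProbabilityMeasure (disorderLaw π) := by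
  unfold disorderLaw
  infer_instance

/-- The centred sum of the observable `h` along the first `n` disorder variables. -/
noncomputable def fluctuation (π : stdSimplex ℝ E') (h : E' → ℝ) (n : ℕ) (η : ℕ → E') : ℝ :=
  ∑ i ∈ Finset.range n, (h (η i) - ∑ b, π b * h b)

omit [MeasurableSpace E'] [MeasurableSingletonClass E'] in
lemma mul_sum_empiricalMeasure_sub_mul_eq_fluctuation [DecidableEq E'] (n : ℕ) (η : ℕ → E') :
    n * ∑ b, (empiricalMeasure (fun i : Fin n => η i) - ⇑π) b * h b = fluctuation π h n η := by
  rcases eq_or_ne n 0 with rfl | hn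
  · simp [fluctuation]
  · simp only [fluctuation, Finset.sum_sub_distrib, Pi.sub_apply, sub_mul, mul_sub]
    rw [← sum_eq_mul_sum_empiricalMeasure hn (fun i : Fin n => η i) h,
      Finset.sum_range fun i => h (η i)]
    simp

omit [MeasurableSpace E'] [MeasurableSingletonClass E'] in
lemma fluctuation_neg (n : ℕ) (η : ℕ → E') :
    fluctuation π (-h) n η = -fluctuation π h n η := by
  simp only [fluctuation, Pi.neg_apply, mul_neg, ← Finset.sum_neg_distrib]
  refine Finset.sum_congr rfl fun i _ => ?_
  simp only [Finset.sum_neg_distrib]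
  ring

@[fun_prop]
lemma measurable_fluctuation (n : ℕ) : Measurable (fluctuation π h n) := by
  have h' : Measurable h := measurable_of_countable h
  unfold fluctuation
  fun_prop

lemma variance_eval_ne_zero (hπ : ∀ b, 0 < π b) (hh : ∀ c, ∃ b, h b ≠ c) :
    Var[fun η : ℕ → E' => h (η 0); disorderLaw π] ≠ 0 := by
  intro hv
  have hm : Measurable fun η : ℕ → E' => h (η 0) :=
    (measurable_of_countable h).comp (measurable_pi_apply 0)
  have hL2 : MemLp (fun η : ℕ → E' => h (η 0)) 2 (disorderLaw π) :=
    MemLp.of_bound hm.aestronglyMeasurable (∑ b, ‖h b‖) (ae_of_all _ fun η =>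
      Finset.single_le_sum (f := fun b => ‖h b‖) (fun b _ => norm_nonneg _) (Finset.mem_univ (η 0)))
  have hae := ae_eq_integral_of_variance_eq_zero hL2 hv
  obtain ⟨b, hb⟩ := hh (∫ η, h (η 0) ∂disorderLaw π)
  have hnull : disorderLaw π (Function.eval 0 ⁻¹' {b}) = 0 :=
    measure_mono_null (fun η (hη : η 0 = b) => by simpa [hη] using hb) hae
  rw [disorderLaw, (measurePreserving_eval_infinitePi (fun _ : ℕ => law π) 0).measure_preimage
    (measurableSet_singleton b).nullMeasurableSet] at hnull
  have hpos := measureReal_law_singleton π b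
  rw [Measure.real, hnull, ENNReal.toReal_zero] at hpos
  exact (hπ b).ne hpos

omit [MeasurableSingletonClass E'] in
lemma iIndepFun_disorderLaw (π : stdSimplex ℝ E') :
    iIndepFun (fun (i : ℕ) (η : ℕ → E') => η i) (disorderLaw π) :=
  iIndepFun_infinitePi (X := fun _ => id) fun _ => measurable_id

/-- The central limit theorem for the fluctuations of a non-constant observable. -/
lemma exists_tendsto_measure_fluctuation (hπ : ∀ b, 0 < π b) (hh : ∀ c, ∃ b, h b ≠ c) :
    ∃ v : NNReal, v ≠ 0 ∧ ∀ s : Set ℝ, MeasurableSet s → gaussianReal 0 v (frontier s) = 0 →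
      Tendsto (fun n : ℕ => disorderLaw π {η | (√(n : ℝ))⁻¹ * fluctuation π h n η ∈ s}) atTop
        (𝓝 (gaussianReal 0 v s)) := by
  have hmh : Measurable h := measurable_of_countable h
  set X : ℕ → (ℕ → E') → ℝ := fun i η => h (η i) with hX
  have hm (i : ℕ) : Measurable (X i) := hmh.comp (measurable_pi_apply i)
  have hL2 : MemLp (X 0) 2 (disorderLaw π) :=
    MemLp.of_bound (hm 0).aestronglyMeasurable (∑ b, ‖h b‖) (ae_of_all _ fun η =>
      Finset.single_le_sum (f := fun b => ‖h b‖) (fun b _ => norm_nonneg _) (Finset.mem_univ (η 0)))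
  have hindep : iIndepFun X (disorderLaw π) := (iIndepFun_disorderLaw π).comp _ fun _ => hmh
  have hident (i : ℕ) : IdentDistrib (X i) (X 0) (disorderLaw π) (disorderLaw π) := by
    refine IdentDistrib.comp (u := h) ⟨(measurable_pi_apply i).aemeasurable,
      (measurable_pi_apply 0).aemeasurable, ?_⟩ hmh
    exact ((measurePreserving_eval_infinitePi (fun _ : ℕ => law π) i).map_eq).trans
      ((measurePreserving_eval_infinitePi (fun _ : ℕ => law π) 0).map_eq).symm
  have hmean : ∫ η, X 0 η ∂disorderLaw π = ∑ b, π b * h b := by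
    have := integral_infinitePi_law (fun _ => π) (n := 1) fun σ => h (σ 0)
    rw [sum_prod_mul_single (q := fun _ => π) (fun _ => π.2.2) 0 h] at this
    exact this
  have hv : Var[X 0; disorderLaw π] ≠ 0 := variance_eval_ne_zero hπ hh
  set v := Var[X 0; disorderLaw π].toNNReal
  have hv0 : v ≠ 0 := by
    simpa [v] using lt_of_le_of_ne (variance_nonneg _ _) hv.symm
  have hclt := tendstoInDistribution_inv_sqrt_mul_sum_sub (P := disorderLaw π)
    (P' := gaussianReal 0 v) (Y := id) (X := X) ⟨aemeasurable_id, Measure.map_id⟩ hL2 hindep hident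
  have hfl (n : ℕ) (η : ℕ → E') : ∑ k ∈ Finset.range n, X k η - n * ∫ η, X 0 η ∂disorderLaw π =
      fluctuation π h n η := by
    rw [hmean, fluctuation, Finset.sum_sub_distrib]
    simp [X]
  refine ⟨v, hv0, fun s hs hfr => ?_⟩
  have hlim := ProbabilityMeasure.tendsto_measure_of_null_frontier_of_tendsto' hclt.tendsto
    (E := s) (by simpa using hfr)
  simp only [ProbabilityMeasure.coe_mk, Measure.map_id, hfl] at hlim
  refine hlim.congr fun n => ?_
  rw [Measure.map_apply (by fun_prop) hs]
  rfl

lemma gaussianReal_Ioi_zero {v : NNReal} (hv : v ≠ 0) :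
    (gaussianReal 0 v).real (Set.Ioi 0) = 1 / 2 := by
  have := nullSingletonClass_gaussianReal (μ := 0) hv
  have hneg : (gaussianReal 0 v).real (Set.Iio 0) = (gaussianReal 0 v).real (Set.Ioi 0) := by
    conv_lhs => rw [← neg_zero (G := ℝ), ← gaussianReal_map_neg, neg_zero]
    rw [map_measureReal_apply measurable_neg measurableSet_Iio]
    congr 1
    ext x
    simp
  have hcompl := probReal_compl_eq_one_sub (μ := gaussianReal 0 v)
    (measurableSet_Ioi (a := (0 : ℝ)))
  rw [Set.compl_Ioi, measureReal_congr Iio_ae_eq_Iic.symm, hneg] at hcompl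
  linarith

lemma tendsto_measureReal_fluctuation_pos (hπ : ∀ b, 0 < π b) (hh : ∀ c, ∃ b, h b ≠ c) :
    Tendsto (fun n => (disorderLaw π).real {η | 0 < fluctuation π h n η}) atTop (𝓝 (1 / 2)) := by
  obtain ⟨v, hv, hlim⟩ := exists_tendsto_measure_fluctuation hπ hh
  have := nullSingletonClass_gaussianReal (μ := 0) hv
  have h1 := (ENNReal.tendsto_toReal (measure_ne_top _ _)).comp
    (hlim (Set.Ioi 0) measurableSet_Ioi (by rw [frontier_Ioi]; exact measure_singleton 0))
  rw [← gaussianReal_Ioi_zero hv]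
  refine h1.congr' ?_
  filter_upwards [eventually_ge_atTop 1] with n hn
  have hs : 0 < (√(n : ℝ))⁻¹ := inv_pos.2 (Real.sqrt_pos.2 (by exact_mod_cast hn))
  simp only [Function.comp_apply, Set.mem_Ioi, mul_pos_iff_of_pos_left hs]
  rfl

/-- With probability close to one the fluctuations are not small on the scale `√n`. -/
lemma eventually_measureReal_abs_fluctuation_lt (hπ : ∀ b, 0 < π b) (hh : ∀ c, ∃ b, h b ≠ c)
    {ε : ℝ} (hε : 0 < ε) : ∃ δ₀ > 0, ∀ δ ≤ δ₀, ∀ᶠ n : ℕ in atTop,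
      (disorderLaw π).real {η | |fluctuation π h n η| < δ * √n} < ε := by
  obtain ⟨v, hv, hlim⟩ := exists_tendsto_measure_fluctuation hπ hh
  have := nullSingletonClass_gaussianReal (μ := 0) hv
  obtain ⟨δ₀, hδε, hδ₀⟩ : ∃ δ₀ > 0, (gaussianReal 0 v).real (Set.Icc (-δ₀) δ₀) < ε := by
    have h0 := (ENNReal.tendsto_toReal ENNReal.zero_ne_top).comp
      ((tendsto_measure_Icc (gaussianReal 0 v) 0).mono_left (nhdsWithin_le_nhds (s := Set.Ioi 0)))
    have h1 := (h0.eventually (gt_mem_nhds (show (0 : ENNReal).toReal < ε by simpa using hε))).and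
      self_mem_nhdsWithin
    obtain ⟨δ₀, h2, h3⟩ := h1.exists
    refine ⟨δ₀, h3, ?_⟩
    simpa [Measure.real] using h2
  refine ⟨δ₀, hδε, fun δ hδ => ?_⟩
  have h1 := (ENNReal.tendsto_toReal (measure_ne_top _ _)).comp
    (hlim (Set.Icc (-δ₀) δ₀) measurableSet_Icc (by
      rw [frontier_Icc (by linarith)]
      exact (Set.toFinite _).measure_zero _))
  filter_upwards [h1.eventually (gt_mem_nhds hδ₀), eventually_ge_atTop 1] with n hn hn1
  have hs : 0 < √(n : ℝ) := Real.sqrt_pos.2 (by exact_mod_cast hn1)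
  refine lt_of_le_of_lt (measureReal_mono fun η hη => ?_) hn
  rw [Set.mem_ofPred_eq] at hη
  have h2 : |fluctuation π h n η| < δ₀ * √n := hη.trans_le (by gcongr)
  rw [abs_lt] at h2
  constructor
  · rw [inv_mul_eq_div, le_div_iff₀ hs]
    linarith [h2.1]
  · rw [inv_mul_eq_div, div_le_iff₀ hs]
    exact h2.2.le

lemma tendsto_measureReal_abs_fluctuation_le (hπ : ∀ b, 0 < π b) (hh : ∀ c, ∃ b, h b ≠ c) (K : ℝ) :
    Tendsto (fun n => (disorderLaw π).real {η | |fluctuation π h n η| ≤ K}) atTop (𝓝 0) := by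
  refine Metric.tendsto_nhds.2 fun ε hε => ?_
  obtain ⟨δ, hδ, hev⟩ := eventually_measureReal_abs_fluctuation_lt hπ hh hε
  have hK : ∀ᶠ n : ℕ in atTop, K < δ * √n :=
    ((Real.tendsto_sqrt_atTop.comp tendsto_natCast_atTop_atTop).const_mul_atTop
      hδ).eventually_gt_atTop K
  filter_upwards [hev δ le_rfl, hK] with n hn hKn
  rw [Real.dist_eq, sub_zero, abs_of_nonneg measureReal_nonneg]
  exact lt_of_le_of_lt (measureReal_mono fun η (hη : _ ≤ _) => lt_of_le_of_lt hη hKn) hn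

/-- With probability close to one the empirical measure of the disorder is at the distance
`O(n^(-1/2))` from `π` (Chebyshev's inequality). -/
lemma measureReal_lt_norm_empiricalMeasure_sub_le [DecidableEq E'] {n : ℕ} (hn : n ≠ 0) {δ : ℝ}
    (hδ : 0 < δ) :
    (disorderLaw π).real {η | δ⁻¹ / √n < ‖empiricalMeasure (fun i : Fin n => η i) - ⇑π‖} ≤
      Fintype.card E' * δ ^ 2 := by
  have hn0 : (0 : ℝ) < n := by positivity
  have hs0 : 0 < √(n : ℝ) := Real.sqrt_pos.2 hn0
  let g : (Fin n → E') → ℝ := fun σ => ‖empiricalMeasure σ - ⇑π‖ ^ 2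
  have hmix : mix (empiricalMeasure fun _ : Fin n => ()) (fun _ => ⇑π) = ⇑π := by
    rw [mix, ← Finset.sum_smul, (empiricalMeasure_mem_stdSimplex hn _).2, one_smul]
  have hint : ∫ η, g (fun i => η i) ∂disorderLaw π ≤ Fintype.card E' / n := by
    rw [disorderLaw, integral_infinitePi_law]
    have := sum_prod_mul_norm_sq_le (ν := fun _ : Unit => ⇑π) hn (fun _ => π.2) fun _ => ()
    rw [hmix] at this
    exact this
  have hm : Measurable fun η : ℕ → E' => g fun i => η i :=
    (measurable_of_countable g).comp (measurable_initial n)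
  have hintegrable : Integrable (fun η : ℕ → E' => g fun i => η i) (disorderLaw π) :=
    Integrable.of_bound hm.aestronglyMeasurable (∑ σ, ‖g σ‖) (ae_of_all _ fun η =>
      Finset.single_le_sum (f := fun σ => ‖g σ‖) (fun σ _ => norm_nonneg _) (Finset.mem_univ _))
  have hmarkov := mul_meas_ge_le_integral_of_nonneg (ae_of_all _ fun η => by positivity)
    hintegrable ((δ⁻¹ / √n) ^ 2)
  have hsub : (disorderLaw π).real {η | δ⁻¹ / √n < ‖empiricalMeasure (fun i : Fin n => η i) - ⇑π‖} ≤
      (disorderLaw π).real {η | (δ⁻¹ / √n) ^ 2 ≤ g fun i => η i} := by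
    refine measureReal_mono fun η hη => ?_
    rw [Set.mem_ofPred_eq] at hη
    exact pow_le_pow_left₀ (by positivity) hη.le 2
  refine hsub.trans ?_
  have h1 := hmarkov.trans hint
  set T := (disorderLaw π).real {η | (δ⁻¹ / √n) ^ 2 ≤ g fun i => η i}
  rw [div_pow, Real.sq_sqrt hn0.le, div_mul_eq_mul_div, div_le_div_iff_of_pos_right hn0, inv_pow,
    inv_mul_le_iff₀ (by positivity)] at h1
  linarith

end Fluctuations

/-! ### Asymptotic independence of the selected phase and the local disorder -/

section Mixing

variable {E' : Type*} [Fintype E'] [MeasurableSpace E'] [MeasurableSingletonClass E']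
  {π : stdSimplex ℝ E'} {h : E' → ℝ}

/-- The sum of `h` over the sites `k, …, n - 1` is independent of the first `k` disorder
variables. -/
lemma setIntegral_fluctuation_sub_pos {k n : ℕ} (φ : (Fin k → E') → ℝ) :
    ∫ η in {η | 0 < ∑ i ∈ Finset.Ico k n, (h (η i) - ∑ b, π b * h b)}, φ (fun i => η i)
        ∂disorderLaw π =
      (disorderLaw π).real {η | 0 < ∑ i ∈ Finset.Ico k n, (h (η i) - ∑ b, π b * h b)} *
        ∫ η, φ (fun i => η i) ∂disorderLaw π := by
  have hmh : Measurable h := measurable_of_countable h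
  have hms : MeasurableSet {η : ℕ → E' | 0 < ∑ i ∈ Finset.Ico k n, (h (η i) - ∑ b, π b * h b)} :=
    measurableSet_lt measurable_const (by fun_prop)
  have hdisj : Disjoint (Finset.Ico k n) (Finset.range k) := by
    rw [Finset.disjoint_left]
    intro i hi hi'
    rw [Finset.mem_Ico] at hi
    rw [Finset.mem_range] at hi'
    omega
  have hind := (iIndepFun_disorderLaw π).indepFun_finset _ _ hdisj fun i => measurable_pi_apply i
  let ψ : (Finset.Ico k n → E') → ℝ := fun y =>
    Set.indicator {y | 0 < ∑ i, (h (y i) - ∑ b, π b * h b)} 1 y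
  let φ' : (Finset.range k → E') → ℝ := fun y => φ fun i => y ⟨i, Finset.mem_range.2 i.2⟩
  have hind' := hind.comp (measurable_of_countable ψ) (measurable_of_countable φ')
  have hψm : Measurable fun η : ℕ → E' => ψ fun i => η i :=
    (measurable_of_countable ψ).comp (measurable_pi_lambda _ fun i => measurable_pi_apply _)
  have hφm : Measurable fun η : ℕ → E' => φ' fun i => η i :=
    (measurable_of_countable φ').comp
      (measurable_pi_lambda (fun (η : ℕ → E') (i : Finset.range k) => η i) fun i =>
        measurable_pi_apply _)
  have hmul := hind'.integral_fun_mul_eq_mul_integral hψm.aestronglyMeasurable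
    hφm.aestronglyMeasurable
  have hψ (η : ℕ → E') : ψ (fun i => η i) =
      Set.indicator {η | 0 < ∑ i ∈ Finset.Ico k n, (h (η i) - ∑ b, π b * h b)} 1 η := by
    simp only [ψ, Set.indicator_apply, Set.mem_ofPred_eq, Pi.one_apply,
      ← Finset.sum_coe_sort (Finset.Ico k n) fun i => h (η i) - ∑ b, π b * h b]
  rw [← integral_indicator hms, ← integral_indicator_one hms]
  simp only [Function.comp_def, hψ] at hmul
  rw [← hmul]
  refine integral_congr_ae (ae_of_all _ fun η => ?_)
  simp only [Set.indicator_apply, Pi.one_apply, φ']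
  split_ifs <;> simp

lemma abs_setIntegral_sub_setIntegral_le {Ω : Type*} [MeasurableSpace Ω] {P : Measure Ω}
    [IsFiniteMeasure P] {A B S : Set Ω} (hA : MeasurableSet A) (hB : MeasurableSet B)
    (hS : MeasurableSet S) {g : Ω → ℝ} (hg : Measurable g) {M : ℝ} (hM : ∀ ω, |g ω| ≤ M)
    (hAB : ∀ ω, ω ∉ S → (ω ∈ A ↔ ω ∈ B)) :
    |∫ ω in A, g ω ∂P - ∫ ω in B, g ω ∂P| ≤ M * P.real S := by
  have hint : Integrable g P := Integrable.of_bound hg.aestronglyMeasurable M (ae_of_all _ hM)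
  rw [← integral_indicator hA, ← integral_indicator hB,
    ← integral_sub (hint.indicator hA) (hint.indicator hB), mul_comm, ← smul_eq_mul,
    ← setIntegral_const, ← integral_indicator hS, ← Real.norm_eq_abs]
  refine norm_integral_le_of_norm_le ((integrable_const M).indicator hS) (ae_of_all _ fun ω => ?_)
  have h0 := hM ω
  have h1 := abs_nonneg (g ω)
  by_cases hω : ω ∈ S
  · by_cases ha : ω ∈ A <;> by_cases hb : ω ∈ B <;> simp [hω, ha, hb] <;> linarith
  · by_cases ha : ω ∈ A
    · simp [hω, ha, (hAB ω hω).1 ha]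
    · simp [hω, ha, mt (hAB ω hω).2 ha]

lemma measurableSet_fluctuation_pos (n : ℕ) : MeasurableSet {η | 0 < fluctuation π h n η} :=
  measurableSet_lt measurable_const (measurable_fluctuation n)

/-- The sign of the fluctuations is asymptotically a fair coin, independent of the first `k`
disorder variables. -/
lemma tendsto_setIntegral_fluctuation_pos_initial (hπ : ∀ b, 0 < π b) (hh : ∀ c, ∃ b, h b ≠ c)
    {k : ℕ} (φ : (Fin k → E') → ℝ) :
    Tendsto (fun n => ∫ η in {η | 0 < fluctuation π h n η}, φ (fun i => η i) ∂disorderLaw π) atTop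
      (𝓝 (1 / 2 * ∫ η, φ (fun i => η i) ∂disorderLaw π)) := by
  have hmh : Measurable h := measurable_of_countable h
  have hφm : Measurable fun η : ℕ → E' => φ fun i => η i :=
    (measurable_of_countable φ).comp (measurable_initial k)
  set M : ℝ := ∑ σ, |φ σ|
  have hM (η : ℕ → E') : |φ fun i => η i| ≤ M :=
    Finset.single_le_sum (f := fun σ => |φ σ|) (fun σ _ => abs_nonneg _) (Finset.mem_univ _)
  set K : ℝ := k * ∑ b, |h b - ∑ b, π b * h b|
  have hK (η : ℕ → E') : |fluctuation π h k η| ≤ K := by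
    refine (Finset.abs_sum_le_sum_abs _ _).trans ?_
    calc _ ≤ ∑ _i ∈ Finset.range k, ∑ b, |h b - ∑ b, π b * h b| :=
          Finset.sum_le_sum fun i _ => Finset.single_le_sum
            (f := fun b => |h b - ∑ b, π b * h b|) (fun b _ => abs_nonneg _)
            (Finset.mem_univ (η i))
      _ = K := by simp [K]
  set A : ℕ → Set (ℕ → E') := fun n => {η | 0 < fluctuation π h n η}
  set B : ℕ → Set (ℕ → E') := fun n =>
    {η | 0 < ∑ i ∈ Finset.Ico k n, (h (η i) - ∑ b, π b * h b)}
  set S : ℕ → Set (ℕ → E') := fun n => {η | |fluctuation π h n η| ≤ K}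
  have hmA (n : ℕ) : MeasurableSet (A n) := measurableSet_fluctuation_pos n
  have hmB (n : ℕ) : MeasurableSet (B n) := measurableSet_lt measurable_const (by fun_prop)
  have hmS (n : ℕ) : MeasurableSet (S n) := by
    exact measurableSet_le (measurable_fluctuation n).norm measurable_const
  have hS0 : Tendsto (fun n => (disorderLaw π).real (S n)) atTop (𝓝 0) :=
    tendsto_measureReal_abs_fluctuation_le hπ hh K
  have hAB {n : ℕ} (hn : k ≤ n) (η : ℕ → E') (hη : η ∉ S n) : η ∈ A n ↔ η ∈ B n := by
    have hsplit : fluctuation π h n η =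
        fluctuation π h k η + ∑ i ∈ Finset.Ico k n, (h (η i) - ∑ b, π b * h b) :=
      (Finset.sum_range_add_sum_Ico _ hn).symm
    have hk' := abs_le.1 (hK η)
    have hη' : K < |fluctuation π h n η| := not_le.1 hη
    change 0 < fluctuation π h n η ↔ 0 < ∑ i ∈ Finset.Ico k n, (h (η i) - ∑ b, π b * h b)
    rcases lt_abs.1 hη' with h1 | h1 <;> constructor <;> intro h2 <;> linarith [hk'.1, hk'.2]
  have hP : Tendsto (fun n => (disorderLaw π).real (B n)) atTop (𝓝 (1 / 2)) := by
    have h1 := tendsto_measureReal_fluctuation_pos hπ hh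
    refine (tendsto_iff_of_dist ?_).1 h1
    refine squeeze_zero' (Eventually.of_forall fun n => dist_nonneg) ?_ hS0
    filter_upwards [eventually_ge_atTop k] with n hn
    have := abs_setIntegral_sub_setIntegral_le (P := disorderLaw π) (hmA n) (hmB n) (hmS n)
      (g := fun _ => 1) measurable_const (M := 1) (by simp) (hAB hn)
    simpa [Real.dist_eq] using this
  have hBint : Tendsto (fun n => ∫ η in B n, φ (fun i => η i) ∂disorderLaw π) atTop
      (𝓝 (1 / 2 * ∫ η, φ (fun i => η i) ∂disorderLaw π)) :=
    (hP.mul_const _).congr fun n => (setIntegral_fluctuation_sub_pos φ).symm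
  refine (tendsto_iff_of_dist ?_).1 hBint
  have hS0' := hS0.const_mul M
  rw [mul_zero] at hS0'
  refine squeeze_zero' (Eventually.of_forall fun n => dist_nonneg) ?_ hS0'
  filter_upwards [eventually_ge_atTop k] with n hn
  rw [dist_comm]
  exact abs_setIntegral_sub_setIntegral_le (hmA n) (hmB n) (hmS n) hφm hM (hAB hn)

variable [TopologicalSpace E'] [DiscreteTopology E']

/-- The sign of the fluctuations is asymptotically independent of the whole disorder sequence:
a continuous function of the sequence is approximated in mean by functions of finitely many
terms. -/
lemma tendsto_setIntegral_fluctuation_pos (hπ : ∀ b, 0 < π b) (hh : ∀ c, ∃ b, h b ≠ c)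
    {g : (ℕ → E') → ℝ} (hg : Continuous g) {M : ℝ} (hM : ∀ η, |g η| ≤ M) :
    Tendsto (fun n => ∫ η in {η | 0 < fluctuation π h n η}, g η ∂disorderLaw π) atTop
      (𝓝 (1 / 2 * ∫ η, g η ∂disorderLaw π)) := by
  obtain ⟨b₀, -⟩ := hh 0
  let y (k : ℕ) (σ : Fin k → E') : ℕ → E' := fun i => if hi : i < k then σ ⟨i, hi⟩ else b₀
  have hy (η : ℕ → E') : Tendsto (fun k => y k fun i => η i) atTop (𝓝 η) := by
    refine tendsto_pi_nhds.2 fun i => tendsto_const_nhds.congr' ?_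
    filter_upwards [eventually_gt_atTop i] with k hk
    simp [y, hk]
  have hgm : Measurable g := hg.measurable
  have hm (k : ℕ) : Measurable fun η : ℕ → E' => g (y k fun i => η i) :=
    (measurable_of_countable fun σ => g (y k σ)).comp (measurable_initial k)
  have hgi : Integrable g (disorderLaw π) :=
    Integrable.of_bound hgm.aestronglyMeasurable M (ae_of_all _ hM)
  have hyi (k : ℕ) : Integrable (fun η : ℕ → E' => g (y k fun i => η i)) (disorderLaw π) :=
    Integrable.of_bound (hm k).aestronglyMeasurable M (ae_of_all _ fun η => hM _)
  have hL1 : Tendsto (fun k => ∫ η, |g η - g (y k fun i => η i)| ∂disorderLaw π) atTop (𝓝 0) := by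
    have := tendsto_integral_of_dominated_convergence (μ := disorderLaw π)
      (F := fun k η => |g η - g (y k fun i => η i)|) (f := fun _ => 0) (fun _ => M + M)
      (fun k => ((hgm.sub (hm k)).norm).aestronglyMeasurable) (integrable_const _)
      (fun k => ae_of_all _ fun η => by
        rw [Real.norm_eq_abs, abs_abs]
        exact (abs_sub _ _).trans (add_le_add (hM _) (hM _)))
      (ae_of_all _ fun η => by
        have := ((tendsto_const_nhds (x := g η)).sub ((hg.tendsto η).comp (hy η))).abs
        simpa using this)
    simpa using this
  refine Metric.tendsto_nhds.2 fun ε hε => ?_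
  obtain ⟨k, hk⟩ := (hL1.eventually (gt_mem_nhds (show 0 < ε / 3 by positivity))).exists
  have hlim := Metric.tendsto_nhds.1
    (tendsto_setIntegral_fluctuation_pos_initial hπ hh fun σ : Fin k → E' => g (y k σ)) (ε / 3)
    (by positivity)
  filter_upwards [hlim] with n hn
  have hset (A : Set (ℕ → E')) : |∫ η in A, g η ∂disorderLaw π -
      ∫ η in A, g (y k fun i => η i) ∂disorderLaw π| < ε / 3 := by
    rw [← integral_sub hgi.integrableOn (hyi k).integrableOn]
    refine lt_of_le_of_lt ((abs_integral_le_integral_abs).trans ?_) hk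
    exact setIntegral_le_integral (hgi.sub (hyi k)).abs (ae_of_all _ fun η => abs_nonneg _)
  have h1 := abs_lt.1 (hset {η | 0 < fluctuation π h n η})
  have h2 := abs_lt.1 (hset Set.univ)
  rw [setIntegral_univ, setIntegral_univ] at h2
  rw [Real.dist_eq, abs_lt] at hn ⊢
  constructor <;> linarith [h1.1, h1.2, h2.1, h2.2, hn.1, hn.2]

end Mixing

/-! ### The metastate -/

section Metastate

variable {E E' : Type*} [Fintype E] [Fintype E'] {F : (E → ℝ) → ℝ} {α : E' → stdSimplex ℝ E}
  {π : stdSimplex ℝ E'} {ν₁ ν₂ : E' → E → ℝ}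

/-- Different stability vectors mean that the difference of the disorder gradients is not constant,
i.e. that the relative weight of the two phases does depend on the disorder. -/
lemma exists_disorderGradient_sub_ne (h2 : NonDegenerate2 F α π) (hne : ν₁ ≠ ν₂)
    (hM : minimizers F α π = {ν₁, ν₂}) (c : ℝ) :
    ∃ b, (disorderGradient F α π ν₂ - disorderGradient F α π ν₁) b ≠ c := by
  by_contra! hc
  refine hne (h2 (by simp [hM]) (by simp [hM]) (funext fun x => ?_))
  rw [stabilityVector_eq, stabilityVector_eq, neg_inj, ← sub_eq_zero, ← Finset.sum_sub_distrib]
  have (b : E') : x.1 b * disorderGradient F α π ν₁ b - x.1 b * disorderGradient F α π ν₂ b =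
      x.1 b * -c := by
    rw [← hc b, Pi.sub_apply]
    ring
  simp_rw [this]
  rw [← Finset.sum_mul, x.2, zero_mul]

variable [DecidableEq E']

lemma mem_favourable_iff {δ : ℝ} {n : ℕ} {η : ℕ → E'} :
    η ∈ favourable F α π ν₁ ν₂ δ n ↔
      ‖empiricalMeasure (fun i : Fin n => η i) - ⇑π‖ ≤ δ⁻¹ / √n ∧
        δ * √n ≤ fluctuation π (disorderGradient F α π ν₂ - disorderGradient F α π ν₁) n η := by
  rw [← mul_sum_empiricalMeasure_sub_mul_eq_fluctuation]
  rfl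

variable [MeasurableSpace E'] [MeasurableSingletonClass E']

lemma measurableSet_favourable (δ : ℝ) (n : ℕ) :
    MeasurableSet (favourable F α π ν₁ ν₂ δ n) :=
  measurable_initial n (Set.toFinite {σ : Fin n → E' | ‖empiricalMeasure σ - ⇑π‖ ≤ δ⁻¹ / √n ∧
    δ * √n ≤ n * ∑ b, (empiricalMeasure σ - ⇑π) b *
      (disorderGradient F α π ν₂ b - disorderGradient F α π ν₁ b)}).measurableSet

/-- With probability close to one the disorder favours one of the two phases. -/
lemma exists_eventually_measureReal_compl_favourable_lt (hπ : ∀ b, 0 < π b)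
    (h2 : NonDegenerate2 F α π) (hne : ν₁ ≠ ν₂) (hM : minimizers F α π = {ν₁, ν₂}) {ε : ℝ}
    (hε : 0 < ε) :
    ∃ δ > 0, ∀ᶠ n : ℕ in atTop, (disorderLaw π).real
      (favourable F α π ν₁ ν₂ δ n ∪ favourable F α π ν₂ ν₁ δ n)ᶜ < ε := by
  set h := disorderGradient F α π ν₂ - disorderGradient F α π ν₁ with hh
  have hneg : disorderGradient F α π ν₁ - disorderGradient F α π ν₂ = -h := by rw [hh, neg_sub]
  obtain ⟨δ₀, hδ₀, hδ⟩ := eventually_measureReal_abs_fluctuation_lt hπ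
    (exists_disorderGradient_sub_ne h2 hne hM) (half_pos hε)
  have hsmall : ∀ᶠ δ : ℝ in 𝓝[>] 0, Fintype.card E' * δ ^ 2 < ε / 2 ∧ δ ≤ δ₀ ∧ 0 < δ := by
    have hc : Continuous fun δ : ℝ => Fintype.card E' * δ ^ 2 := by fun_prop
    have h0 := (hc.tendsto 0).mono_left (nhdsWithin_le_nhds (s := Set.Ioi 0))
    have hle : ∀ᶠ δ : ℝ in 𝓝[>] 0, δ ≤ δ₀ := nhdsWithin_le_nhds (Iic_mem_nhds hδ₀)
    exact (h0.eventually (gt_mem_nhds (by simpa using hε))).and (hle.and self_mem_nhdsWithin)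
  obtain ⟨δ, h1, hle, hpos⟩ := hsmall.exists
  refine ⟨δ, hpos, ?_⟩
  filter_upwards [hδ δ hle, eventually_ne_atTop 0] with n hn hn0
  have hsub : (favourable F α π ν₁ ν₂ δ n ∪ favourable F α π ν₂ ν₁ δ n)ᶜ ⊆
      {η | δ⁻¹ / √n < ‖empiricalMeasure (fun i : Fin n => η i) - ⇑π‖} ∪
        {η | |fluctuation π h n η| < δ * √n} := by
    intro η hη
    by_contra hcon
    simp only [Set.mem_union, Set.mem_ofPred_eq, not_or, not_lt] at hcon
    refine hη ?_
    rcases le_abs.1 hcon.2 with hW | hW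
    · exact Or.inl (mem_favourable_iff.2 ⟨hcon.1, hW⟩)
    · refine Or.inr (mem_favourable_iff.2 ⟨hcon.1, ?_⟩)
      rwa [hneg, fluctuation_neg]
  calc _ ≤ _ := measureReal_mono hsub
    _ ≤ _ := measureReal_union_le _ _
    _ < ε := by
        have := measureReal_lt_norm_empiricalMeasure_sub_le (π := π) hn0 hpos
        linarith

variable [DecidableEq E] [Nonempty E] [TopologicalSpace E] [DiscreteTopology E]
  [MeasurableSpace E] [MeasurableSingletonClass E] [TopologicalSpace E'] [DiscreteTopology E']

/-- On the event that the disorder favours `ν₁`, the Gibbs measure may be replaced by the pure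
phase. The convergence holds for every fixed disorder sequence. -/
lemma tendsto_integral_indicator_favourable (hF : ContDiffOn ℝ 2 F (stdSimplex ℝ E))
    (hπ : ∀ b, 0 < π b) (hM : minimizers F α π = {ν₁, ν₂}) {δ : ℝ} (hδ : 0 < δ)
    (Ξ : (ProbabilityMeasure (ℕ → E) × (ℕ → E')) →ᵇ ℝ) :
    Tendsto (fun n : ℕ => ∫ η, (favourable F α π ν₁ ν₂ δ n).indicator
      (fun η => Ξ (gibbs F α n η, η) - Ξ (purePhase F α π ν₁ η, η)) η ∂disorderLaw π) atTop
      (𝓝 0) := by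
  have hm (n : ℕ) : Continuous fun η : ℕ → E' =>
      Ξ (gibbs F α n η, η) - Ξ (purePhase F α π ν₁ η, η) :=
    (Ξ.continuous.comp ((continuous_gibbs F α n).prodMk continuous_id)).sub
      (Ξ.continuous.comp ((continuous_purePhase F α π ν₁).prodMk continuous_id))
  have := tendsto_integral_of_dominated_convergence (μ := disorderLaw π)
    (F := fun n η => (favourable F α π ν₁ ν₂ δ n).indicator
      (fun η => Ξ (gibbs F α n η, η) - Ξ (purePhase F α π ν₁ η, η)) η) (f := fun _ => 0)
    (fun _ => ‖Ξ‖ + ‖Ξ‖)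
    (fun n => ((hm n).measurable.indicator (measurableSet_favourable δ n)).aestronglyMeasurable)
    (integrable_const _)
    (fun n => ae_of_all _ fun η => (norm_indicator_le_norm_self _ _).trans
      ((norm_sub_le _ _).trans (add_le_add (Ξ.norm_coe_le_norm _) (Ξ.norm_coe_le_norm _))))
    (ae_of_all _ fun η => by
      have h1 : Tendsto (fun n => Ξ (gibbs F α n η, η) - Ξ (purePhase F α π ν₁ η, η))
          (atTop ⊓ 𝓟 {n | η ∈ favourable F α π ν₁ ν₂ δ n}) (𝓝 0) := by
        have h2 := (Ξ.continuous.tendsto (purePhase F α π ν₁ η, η)).comp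
          ((tendsto_gibbs_purePhase hF hπ hM hδ η).prodMk_nhds (tendsto_const_nhds (x := η)))
        simpa using h2.sub_const (Ξ (purePhase F α π ν₁ η, η))
      refine Metric.tendsto_nhds.2 fun ε hε => ?_
      have h3 := eventually_inf_principal.1 (Metric.tendsto_nhds.1 h1 ε hε)
      filter_upwards [h3] with n hn
      by_cases hη : η ∈ favourable F α π ν₁ ν₂ δ n
      · rw [Set.indicator_of_mem hη]
        exact hn hη
      · rw [Set.indicator_of_notMem hη, dist_self]
        exact hε)
  simpa using this

/-- Convergence of the joint law of the Gibbs measure and the disorder. -/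
theorem tendsto_integral_gibbs (hF : ContDiffOn ℝ 2 F (stdSimplex ℝ E))
    (hπ : ∀ b, 0 < π b) (h2 : NonDegenerate2 F α π) (hne : ν₁ ≠ ν₂)
    (hM : minimizers F α π = {ν₁, ν₂}) (Ξ : (ProbabilityMeasure (ℕ → E) × (ℕ → E')) →ᵇ ℝ) :
    Tendsto (fun n : ℕ => ∫ η, Ξ (gibbs F α n η, η) ∂disorderLaw π) atTop
      (𝓝 (1 / 2 * ∫ η, Ξ (purePhase F α π ν₁ η, η) ∂disorderLaw π +
        1 / 2 * ∫ η, Ξ (purePhase F α π ν₂ η, η) ∂disorderLaw π)) := by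
  have hM' : minimizers F α π = {ν₂, ν₁} := by rw [hM, Set.pair_comm]
  set h := disorderGradient F α π ν₂ - disorderGradient F α π ν₁ with hh
  have hneg : disorderGradient F α π ν₁ - disorderGradient F α π ν₂ = -h := by rw [hh, neg_sub]
  have hfluct := exists_disorderGradient_sub_ne h2 hne hM
  have hfluct' := exists_disorderGradient_sub_ne h2 hne.symm hM'
  rw [hneg] at hfluct'
  set g₁ : (ℕ → E') → ℝ := fun η => Ξ (purePhase F α π ν₁ η, η)
  set g₂ : (ℕ → E') → ℝ := fun η => Ξ (purePhase F α π ν₂ η, η)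
  set G : ℕ → (ℕ → E') → ℝ := fun n η => Ξ (gibbs F α n η, η)
  have hg₁ : Continuous g₁ :=
    Ξ.continuous.comp ((continuous_purePhase F α π ν₁).prodMk continuous_id)
  have hg₂ : Continuous g₂ :=
    Ξ.continuous.comp ((continuous_purePhase F α π ν₂).prodMk continuous_id)
  have hG (n : ℕ) : Continuous (G n) :=
    Ξ.continuous.comp ((continuous_gibbs F α n).prodMk continuous_id)
  have hint {g : (ℕ → E') → ℝ} (hg : Continuous g) (hb : ∀ η, |g η| ≤ ‖Ξ‖) :
      Integrable g (disorderLaw π) :=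
    Integrable.of_bound hg.measurable.aestronglyMeasurable ‖Ξ‖ (ae_of_all _ hb)
  have hb₁ (η : ℕ → E') : |g₁ η| ≤ ‖Ξ‖ := Ξ.norm_coe_le_norm _
  have hb₂ (η : ℕ → E') : |g₂ η| ≤ ‖Ξ‖ := Ξ.norm_coe_le_norm _
  have hbG (n : ℕ) (η : ℕ → E') : |G n η| ≤ ‖Ξ‖ := Ξ.norm_coe_le_norm _
  set P₁ : ℕ → Set (ℕ → E') := fun n => {η | 0 < fluctuation π h n η}
  set P₂ : ℕ → Set (ℕ → E') := fun n => {η | 0 < fluctuation π (-h) n η}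
  have hP₁ (n : ℕ) : MeasurableSet (P₁ n) := measurableSet_fluctuation_pos n
  have hP₂ (n : ℕ) : MeasurableSet (P₂ n) := measurableSet_fluctuation_pos n
  have hlim := (tendsto_setIntegral_fluctuation_pos hπ hfluct hg₁ hb₁).add
    (tendsto_setIntegral_fluctuation_pos hπ hfluct' hg₂ hb₂)
  refine (tendsto_iff_of_dist (Metric.tendsto_nhds.2 fun ε hε => ?_)).1 hlim
  obtain ⟨δ, hδ, hR⟩ := exists_eventually_measureReal_compl_favourable_lt hπ h2 hne hM
    (show 0 < ε / (3 * (3 * ‖Ξ‖ + 1)) by positivity)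
  set A₁ : ℕ → Set (ℕ → E') := fun n => favourable F α π ν₁ ν₂ δ n
  set A₂ : ℕ → Set (ℕ → E') := fun n => favourable F α π ν₂ ν₁ δ n
  have hA₁ (n : ℕ) : MeasurableSet (A₁ n) := measurableSet_favourable δ n
  have hA₂ (n : ℕ) : MeasurableSet (A₂ n) := measurableSet_favourable δ n
  have hlim₁ := Metric.tendsto_nhds.1 (tendsto_integral_indicator_favourable hF hπ hM hδ Ξ)
    (ε / 3) (by positivity)
  have hlim₂ := Metric.tendsto_nhds.1 (tendsto_integral_indicator_favourable hF hπ hM' hδ Ξ)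
    (ε / 3) (by positivity)
  filter_upwards [hR, hlim₁, hlim₂, eventually_ne_atTop 0] with n hRn h1n h2n hn0
  have hs0 : 0 < √(n : ℝ) := Real.sqrt_pos.2 (by positivity)
  -- On the rare event `R` the disorder favours neither phase. Off `R` the error `D` vanishes, since
  -- a favourable fluctuation has the corresponding sign.
  set R := (A₁ n ∪ A₂ n)ᶜ with hRdef
  have hRm : MeasurableSet R := ((hA₁ n).union (hA₂ n)).compl
  set D : (ℕ → E') → ℝ := fun η => G n η - (A₁ n).indicator (fun η => G n η - g₁ η) η -
    (A₂ n).indicator (fun η => G n η - g₂ η) η - (P₁ n).indicator g₁ η - (P₂ n).indicator g₂ η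
  have hD (η : ℕ → E') : ‖D η‖ ≤ R.indicator (fun _ => 3 * ‖Ξ‖) η := by
    have hpos₁ : η ∈ A₁ n → 0 < fluctuation π h n η := fun hη =>
      (mul_pos hδ hs0).trans_le (mem_favourable_iff.1 hη).2
    have hpos₂ : η ∈ A₂ n → 0 < -fluctuation π h n η := fun hη => by
      have := (mul_pos hδ hs0).trans_le (mem_favourable_iff.1 hη).2
      rwa [hneg, fluctuation_neg] at this
    have hmem₂ : η ∈ P₂ n ↔ 0 < -fluctuation π h n η := by
      rw [← fluctuation_neg]
      rfl
    by_cases h1 : η ∈ A₁ n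
    · have h2 : η ∉ A₂ n := fun hc => by linarith [hpos₁ h1, hpos₂ hc]
      have h3 : η ∈ P₁ n := hpos₁ h1
      have h4 : η ∉ P₂ n := fun hc => by linarith [hpos₁ h1, hmem₂.1 hc]
      simp [D, R, h1, h2, h3, h4]
    by_cases h2 : η ∈ A₂ n
    · have h3 : η ∉ P₁ n := fun hc => by
        linarith [hpos₂ h2, show 0 < fluctuation π h n η from hc]
      have h4 : η ∈ P₂ n := hmem₂.2 (hpos₂ h2)
      simp [D, R, h1, h2, h3, h4]
    · have h3 : |(P₁ n).indicator g₁ η| ≤ ‖Ξ‖ :=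
        (norm_indicator_le_norm_self (s := P₁ n) g₁ η).trans (hb₁ η)
      have h4 : |(P₂ n).indicator g₂ η| ≤ ‖Ξ‖ :=
        (norm_indicator_le_norm_self (s := P₂ n) g₂ η).trans (hb₂ η)
      have h5 := hbG n η
      have hmem : η ∈ R := by simp [R, h1, h2]
      rw [Set.indicator_of_mem hmem, Real.norm_eq_abs]
      simp only [D, Set.indicator_of_notMem h1, Set.indicator_of_notMem h2, sub_zero]
      rw [abs_le] at *
      constructor <;> linarith [h3.1, h3.2, h4.1, h4.2, h5.1, h5.2]
  have hDle : |∫ η, D η ∂disorderLaw π| < ε / 3 := by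
    refine (norm_integral_le_of_norm_le ((integrable_const _).indicator hRm)
      (ae_of_all _ hD)).trans_lt ?_
    rw [integral_indicator hRm, setIntegral_const, smul_eq_mul]
    calc _ ≤ ε / (3 * (3 * ‖Ξ‖ + 1)) * (3 * ‖Ξ‖) := by gcongr
      _ < ε / 3 := by
        rw [div_mul_eq_mul_div, div_lt_div_iff₀ (by positivity) (by norm_num)]
        nlinarith [norm_nonneg Ξ]
  have hiG := hint (hG n) (hbG n)
  have hi₁ := hint hg₁ hb₁
  have hi₂ := hint hg₂ hb₂
  have hID : ∫ η, D η ∂disorderLaw π = ∫ η, G n η ∂disorderLaw π -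
      ∫ η, (A₁ n).indicator (fun η => G n η - g₁ η) η ∂disorderLaw π -
      ∫ η, (A₂ n).indicator (fun η => G n η - g₂ η) η ∂disorderLaw π -
      ∫ η in P₁ n, g₁ η ∂disorderLaw π - ∫ η in P₂ n, g₂ η ∂disorderLaw π := by
    have j1 : Integrable ((A₁ n).indicator fun η => G n η - g₁ η) (disorderLaw π) :=
      (hiG.sub hi₁).indicator (hA₁ n)
    have j2 : Integrable ((A₂ n).indicator fun η => G n η - g₂ η) (disorderLaw π) :=
      (hiG.sub hi₂).indicator (hA₂ n)
    have j3 := hi₁.indicator (hP₁ n)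
    have j4 := hi₂.indicator (hP₂ n)
    rw [← integral_indicator (hP₁ n), ← integral_indicator (hP₂ n), ← integral_sub' hiG j1,
      ← integral_sub' (hiG.sub j1) j2, ← integral_sub' ((hiG.sub j1).sub j2) j3,
      ← integral_sub' (((hiG.sub j1).sub j2).sub j3) j4]
    rfl
  rw [hID] at hDle
  rw [Real.dist_eq, sub_zero] at h1n h2n
  rw [Real.dist_eq, sub_zero, abs_of_nonneg dist_nonneg, dist_comm, Real.dist_eq]
  rw [abs_lt] at *
  constructor <;> linarith [hDle.1, hDle.2, h1n.1, h1n.2, h2n.1, h2n.2]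

end Metastate

section SymmetricMixture

variable {X Y : Type*} [MeasurableSpace X] [MeasurableSpace Y]

/-- The kernel `y ↦ ½ δ_{f(y)} + ½ δ_{g(y)}`. -/
noncomputable def symmetricMixture {f g : Y → X} (hf : Measurable f) (hg : Measurable g) :
    Kernel Y X where
  toFun y := (2⁻¹ : ℝ≥0∞) • Measure.dirac (f y) + (2⁻¹ : ℝ≥0∞) • Measure.dirac (g y)
  measurable' := by
    refine Measure.measurable_of_measurable_coe _ fun s hs => ?_
    simp only [Measure.add_apply, Measure.smul_apply, smul_eq_mul]
    exact (((Measure.measurable_coe hs).comp (Measure.measurable_dirac.comp hf)).const_mul _).add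
      (((Measure.measurable_coe hs).comp (Measure.measurable_dirac.comp hg)).const_mul _)

variable {f g : Y → X} (hf : Measurable f) (hg : Measurable g)

lemma symmetricMixture_apply (y : Y) : symmetricMixture hf hg y =
    (2⁻¹ : ℝ≥0∞) • Measure.dirac (f y) + (2⁻¹ : ℝ≥0∞) • Measure.dirac (g y) :=
  rfl

instance isMarkovKernel_symmetricMixture : IsMarkovKernel (symmetricMixture hf hg) :=
  ⟨fun y => ⟨by simp [symmetricMixture_apply, ENNReal.inv_two_add_inv_two]⟩⟩

lemma integral_compProd_symmetricMixture (P : Measure Y) [IsProbabilityMeasure P]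
    {Ξ : Y × X → ℝ} (hΞ : Measurable Ξ) {C : ℝ} (hC : ∀ z, ‖Ξ z‖ ≤ C) :
    ∫ z, Ξ z ∂(P ⊗ₘ symmetricMixture hf hg) =
      1 / 2 * ∫ y, Ξ (y, f y) ∂P + 1 / 2 * ∫ y, Ξ (y, g y) ∂P := by
  have hint (u : Y → X) (hu : Measurable u) : Integrable (fun y => Ξ (y, u y)) P :=
    Integrable.of_bound (hΞ.comp (measurable_id.prodMk hu)).aestronglyMeasurable C
      (ae_of_all _ fun y => hC _)
  rw [Measure.integral_compProd (Integrable.of_bound hΞ.aestronglyMeasurable C (ae_of_all _ hC)),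
    ← integral_const_mul, ← integral_const_mul,
    ← integral_add ((hint f hf).const_mul _) ((hint g hg).const_mul _)]
  refine integral_congr_ae (ae_of_all _ fun y => ?_)
  have hy : Measurable fun x => Ξ (y, x) := hΞ.comp measurable_prodMk_left
  have hd (x : X) : Integrable (fun x => Ξ (y, x)) ((2⁻¹ : ℝ≥0∞) • Measure.dirac x) :=
    (Integrable.of_bound hy.aestronglyMeasurable C (ae_of_all _ fun x => hC _)).smul_measure
      (by simp)
  simp only [symmetricMixture_apply]
  rw [integral_add_measure (hd _) (hd _), integral_smul_measure, integral_smul_measure,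
    integral_dirac' _ _ hy.stronglyMeasurable, integral_dirac' _ _ hy.stronglyMeasurable]
  simp

end SymmetricMixture

end MeanField

open MeanField in
theorem mainTheorem3 {E E' : Type*}
    [Fintype E] [Nonempty E] [DecidableEq E] [TopologicalSpace E] [DiscreteTopology E]
    [MeasurableSpace E] [MeasurableSingletonClass E]
    [Fintype E'] [TopologicalSpace E'] [DiscreteTopology E']
    [MeasurableSpace E'] [MeasurableSingletonClass E']
    (F : (E → ℝ) → ℝ) (hF : ContDiffOn ℝ 2 F (stdSimplex ℝ E))
    (α : E' → stdSimplex ℝ E)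
    (π : stdSimplex ℝ E') (hπ : ∀ b, 0 < π b)
    (h1 : MeanField.NonDegenerate1 F α π) (h2 : MeanField.NonDegenerate2 F α π)
    (ν₁ ν₂ : E' → E → ℝ) (hne : ν₁ ≠ ν₂) (hM : MeanField.minimizers F α π = {ν₁, ν₂}) :
    (∃ κ : Kernel (ℕ → E') (ProbabilityMeasure (ℕ → E)), MeanField.IsAWMetastate F α π κ) ∧
    ∀ κ : Kernel (ℕ → E') (ProbabilityMeasure (ℕ → E)), MeanField.IsAWMetastate F α π κ →
      ∀ᵐ η ∂(MeanField.disorderLaw π),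
        κ η = (2⁻¹ : ℝ≥0∞) • Measure.dirac (MeanField.purePhase F α π ν₁ η) +
          (2⁻¹ : ℝ≥0∞) • Measure.dirac (MeanField.purePhase F α π ν₂ η) := by
  classical
  have hm (ν : E' → E → ℝ) : Measurable (purePhase F α π ν) :=
    (continuous_purePhase F α π ν).measurable
  let κ₀ := symmetricMixture (hm ν₁) (hm ν₂)
  let J₀ := (disorderLaw π ⊗ₘ κ₀).map Prod.swap
  have hσ : SigmaFinite (disorderLaw π) := inferInstance
  have hs : SFinite (disorderLaw π) := inferInstance
  have hJ₀ : IsProbabilityMeasure J₀ :=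
    Measure.isProbabilityMeasure_map measurable_swap.aemeasurable
  have hlim (Ξ : (ProbabilityMeasure (ℕ → E) × (ℕ → E')) →ᵇ ℝ) :
      Tendsto (fun n : ℕ => ∫ η, Ξ (gibbs F α n η, η) ∂disorderLaw π) atTop (𝓝 (∫ z, Ξ z ∂J₀)) := by
    rw [integral_map measurable_swap.aemeasurable Ξ.continuous.measurable.aestronglyMeasurable,
      integral_compProd_symmetricMixture (Ξ := fun z => Ξ z.swap) (hm ν₁) (hm ν₂) (disorderLaw π)
        (Ξ.continuous.measurable.comp measurable_swap) fun z => Ξ.norm_coe_le_norm _]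
    exact tendsto_integral_gibbs hF hπ h2 hne hM Ξ
  have hswap : J₀.map (fun ω => (ω.2, ω.1)) = disorderLaw π ⊗ₘ κ₀ := by
    rw [Measure.map_map (by fun_prop) measurable_swap]
    exact Measure.map_id
  have hsnd : J₀.map Prod.snd = disorderLaw π := by
    have hfst := Measure.fst_compProd (disorderLaw π) κ₀
    rwa [Measure.map_map measurable_snd measurable_swap]
  refine ⟨⟨κ₀, J₀, hJ₀, hlim, inferInstance, ?_⟩, ?_⟩
  · exact ⟨by fun_prop, by rw [hsnd, hswap]⟩
  · rintro κ ⟨J, hJ, hJlim, hκ, hcond⟩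
    -- A probability measure is determined by the integrals of bounded continuous functions.
    obtain rfl : J = J₀ := ext_of_forall_integral_eq_of_IsFiniteMeasure fun Ξ =>
      tendsto_nhds_unique (hJlim Ξ) (hlim Ξ)
    have heq := hcond.map_eq
    rw [hsnd, hswap] at heq
    exact (Kernel.ae_eq_of_compProd_eq heq).symm
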